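/- Let $\mathbb{D}$ be the open unit disk, $dA$ normalized area measure on $\mathbb{D}$, $\mathbb{T}$ the unit circle with normalized arc length, and $H^2$, $H^\infty$ the Hardy spaces. For a non-negative $\omega\in L^1(\mathbb{D},dA)$ let $\mathcal{D}_\omega$ be the space of holomorphic functions $f$ on $\mathbb{D}$ with $\mathcal{D}_\omega(f):=\int_{\mathbb{D}}|f'|^2\omega\,dA<\infty$, with $\|f\|_{\mathcal{D}_\omega}^2:=\|f\|_{H^2}^2+\mathcal{D}_\omega(f)$ for $f \in \mathcal{D}_\omega\cap H^2$. For $b\in H^\infty$ with $\|b\|_{H^\infty}\le 1$ let $\mathcal{H}(b)$ be the de Branges--Rovnyak space, i.e. the image of $H^2$ under $(I-T_bT_{\overline b})^{1/2}$ (where $T_\psi f=P_+(\psi f)$ is the Toeplitz operator on $H^2$ with symbol $\psi$), with the norm that makes $(I-T_bT_{\overline b})^{1/2}$ a partial isometry of $H^2$ onto $\mathcal{H}(b)$. Let $b$ be in the closed unit ball of $H^\infty$, and suppose that there is a non-negative weight $\omega$ on $\mathbb{D}$ with $0<\|\omega\|_{L^1(\mathbb{D})}<\infty$ such that $\mathcal{H}(b)=\mathcal{D}_\omega$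 with equality of norms. Then $b$ is a non-extreme point of the closed unit ball of $H^\infty$, and the inner factor of $b$ is $z$ (up to the usual unimodular constant), i.e. $b(z)=z\,g(z)$ with $g$ outer. Consequently, there is an outer function $a\in H^\infty$ with $a(0)>0$ and $|a|^2+|b|^2=1$ a.e. on $\mathbb{T}$, and for this $a$ the inner factor of the associated function $\phi:=b/a$ is also $z$, i.e. $\phi(z)=z\,h(z)$ with $h$ outer. -/

import Mathlib

open MeasureTheory Set Filter Topology
open scoped ENNReal

noncomputable section

namespace DBR

/-! ### The circle, the disk, Hardy spaces -/

/-- The unit circle, parametrized by `t ↦ e^{2πit}`. -/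
abbrev Circ : Type := UnitAddCircle

/-- Normalized arc length `|dλ| / 2π` on the unit circle. -/
abbrev arc : Measure Circ := AddCircle.haarAddCircle

/-- The point `e^{2πit}` of the unit circle in `ℂ`. -/
def pt (t : Circ) : ℂ := (AddCircle.toCircle t : ℂ)

/-- The open unit disk. -/
abbrev disk : Set ℂ := Metric.ball 0 1

/-- The Hardy space `H²`, as the closed subspace of `L²` of the circle consisting of the functions
whose Fourier coefficients of negative index vanish. -/
def Hardy2 : Submodule ℂ (Lp ℂ 2 arc) where
  carrier := {f | ∀ n : ℤ, n < 0 → fourierCoeff f n = 0}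
  add_mem' := by
    intro f g hf hg n hn
    simp only [Set.mem_ofPred_eq] at hf hg
    have hf' := hf n hn
    have hg' := hg n hn
    rw [← fourierBasis_repr] at hf' hg' ⊢
    rw [map_add]
    simp [hf', hg']
  zero_mem' := by
    intro n _
    rw [← fourierBasis_repr, map_zero]
    rfl
  smul_mem' := by
    intro c f hf n hn
    simp only [Set.mem_ofPred_eq] at hf
    have hf' := hf n hn
    rw [← fourierBasis_repr] at hf' ⊢
    rw [map_smul]
    simp [hf']

theorem mem_Hardy2 {f : Lp ℂ 2 arc} : f ∈ Hardy2 ↔ ∀ n : ℤ, n < 0 → fourierCoeff f n = 0 :=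
  Iff.rfl

theorem isClosed_Hardy2 : IsClosed (Hardy2 : Set (Lp ℂ 2 arc)) := by
  have : (Hardy2 : Set (Lp ℂ 2 arc)) =
      ⋂ n : ℤ, ⋂ _ : n < 0, {f | inner ℂ (fourierLp (T := 1) 2 n) f = (0 : ℂ)} := by
    ext f
    simp only [SetLike.mem_coe, mem_Hardy2, Set.mem_iInter, Set.mem_ofPred_eq]
    refine forall₂_congr fun n _ => ?_
    rw [← fourierBasis_repr, HilbertBasis.repr_apply_apply, coe_fourierBasis]
  rw [this]
  exact isClosed_iInter fun n => isClosed_iInter fun _ =>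
    isClosed_eq (by fun_prop) continuous_const

instance : CompleteSpace Hardy2 := isClosed_Hardy2.completeSpace_coe

/-- The space `H^∞`, as the subspace of `L^∞` of the circle consisting of the functions whose
Fourier coefficients of negative index vanish; its norm is the `L^∞` norm. -/
def HInf : Submodule ℂ (Lp ℂ ∞ arc) where
  carrier := {f | ∀ n : ℤ, n < 0 → fourierCoeff f n = 0}
  add_mem' := by
    intro f g hf hg n hn
    simp only [Set.mem_ofPred_eq] at hf hg
    have hf' := hf n hn
    have hg' := hg n hn
    have hif : Integrable f arc := (Lp.memLp f).integrable le_top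
    have hig : Integrable g arc := (Lp.memLp g).integrable le_top
    rw [fourierCoeff_congr_ae (Lp.coeFn_add f g), fourierCoeff.add hif hig]
    simp [hf', hg']
  zero_mem' := by
    intro n _
    rw [fourierCoeff_congr_ae (Lp.coeFn_zero ℂ ∞ arc)]
    simp [fourierCoeff]
  smul_mem' := by
    intro c f hf n hn
    simp only [Set.mem_ofPred_eq] at hf
    have hf' := hf n hn
    rw [fourierCoeff_congr_ae (Lp.coeFn_smul c f), fourierCoeff.const_smul]
    simp [hf']

/-- The holomorphic function `z ↦ ∑_{n ≥ 0} f̂(n) zⁿ` on the disk with boundary function `f`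
(for `f` in `H²` or `H^∞`). -/
def ext (f : Circ → ℂ) (z : ℂ) : ℂ := ∑' n : ℕ, fourierCoeff f n * z ^ n

/-! ### Toeplitz operators and de Branges–Rovnyak spaces -/

/-- Multiplication by `ψ ∈ L^∞` on `L²`. -/
def mulOp (ψ : Lp ℂ ∞ arc) : Lp ℂ 2 arc →L[ℂ] Lp ℂ 2 arc :=
  (ContinuousLinearMap.mul ℂ ℂ).holderL arc ∞ 2 2 ψ

/-- The Toeplitz operator `T_ψ f = P₊(ψ f)` on `H²`. -/
def toeplitz (ψ : Lp ℂ ∞ arc) : Hardy2 →L[ℂ] Hardy2 :=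
  Hardy2.orthogonalProjectionOnto ∘L mulOp ψ ∘L Hardy2.subtypeL

/-- The positive square root of a positive operator on a Hilbert space. -/
def opSqrt {H : Type*} [NormedAddCommGroup H] [InnerProductSpace ℂ H] [CompleteSpace H]
    (A : H →L[ℂ] H) : H →L[ℂ] H :=
  CFC.sqrt A

theorem opSqrt_nonneg {H : Type*} [NormedAddCommGroup H] [InnerProductSpace ℂ H] [CompleteSpace H]
    (A : H →L[ℂ] H) : 0 ≤ opSqrt A :=
  CFC.sqrt_nonneg A

theorem opSqrt_mul_self {H : Type*} [NormedAddCommGroup H] [InnerProductSpace ℂ H]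
    [CompleteSpace H] (T : H →L[ℂ] H) (hT : ‖T‖ ≤ 1) :
    opSqrt (1 - T * star T) * opSqrt (1 - T * star T) = 1 - T * star T := by
  refine CFC.sqrt_mul_sqrt_self _ ?_
  rw [ContinuousLinearMap.nonneg_iff_isPositive]
  refine ⟨(IsSelfAdjoint.sub (IsSelfAdjoint.one _) (IsSelfAdjoint.mul_star_self T)).isSymmetric,
    fun x => ?_⟩
  have h1 : inner ℂ ((T * star T) x) x = (‖star T x‖ ^ 2 : ℂ) := by
    rw [mul_apply_eq_comp, ← ContinuousLinearMap.adjoint_inner_right,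
      ← ContinuousLinearMap.star_eq_adjoint, inner_self_eq_norm_sq_to_K]
    rfl
  have h2 : ‖star T x‖ ≤ ‖x‖ := by
    calc ‖star T x‖ ≤ ‖star T‖ * ‖x‖ := ContinuousLinearMap.le_opNorm _ _
      _ ≤ 1 * ‖x‖ := by gcongr; rwa [norm_star]
      _ = ‖x‖ := one_mul _
  simp only [ContinuousLinearMap.reApplyInnerSelf_apply, sub_apply,
    one_apply_eq_self, inner_sub_left, h1, inner_self_eq_norm_sq_to_K]
  have h3 : ‖star T x‖ ^ 2 ≤ ‖x‖ ^ 2 := by gcongr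
  simpa [← Complex.ofReal_pow] using h3

/-- The operator `(I - T_b T_{b̄})^{1/2}` on `H²`. -/
def defect (b : HInf) : Hardy2 →L[ℂ] Hardy2 :=
  opSqrt (1 - toeplitz (b : Lp ℂ ∞ arc) * toeplitz (star (b : Lp ℂ ∞ arc)))

theorem toeplitz_star (ψ : Lp ℂ ∞ arc) : toeplitz (star ψ) = star (toeplitz ψ) := by
  rw [ContinuousLinearMap.star_eq_adjoint, ContinuousLinearMap.eq_adjoint_iff]
  intro f g
  simp only [toeplitz, ContinuousLinearMap.comp_apply, Submodule.subtypeL_apply]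
  rw [Submodule.inner_orthogonalProjectionOnto_eq_of_mem_right,
    Submodule.inner_orthogonalProjectionOnto_eq_of_mem_left]
  simp only [L2.inner_def]
  refine integral_congr_ae ?_
  have h1 := (ContinuousLinearMap.mul ℂ ℂ).coeFn_holder (r := 2) (star ψ) (f : Lp ℂ 2 arc)
  have h2 := (ContinuousLinearMap.mul ℂ ℂ).coeFn_holder (r := 2) ψ (g : Lp ℂ 2 arc)
  filter_upwards [h1, h2, Lp.coeFn_star ψ] with t h1 h2 h3
  simp only [mulOp, ContinuousLinearMap.holderL_apply_apply]
  rw [h1, h2, h3]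
  simp
  ring

theorem norm_toeplitz_le (ψ : Lp ℂ ∞ arc) : ‖toeplitz ψ‖ ≤ ‖ψ‖ := by
  refine ContinuousLinearMap.opNorm_le_bound _ (norm_nonneg _) fun f => ?_
  have h : ‖toeplitz ψ f‖ ≤ ‖mulOp ψ (f : Lp ℂ 2 arc)‖ :=
    Submodule.norm_orthogonalProjectionOnto_apply_le Hardy2 (mulOp ψ (f : Lp ℂ 2 arc))
  refine h.trans ?_
  calc ‖mulOp ψ (f : Lp ℂ 2 arc)‖ ≤ ‖ContinuousLinearMap.mul ℂ ℂ‖ * ‖ψ‖ * ‖(f : Lp ℂ 2 arc)‖ :=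
        (ContinuousLinearMap.mul ℂ ℂ).norm_holder_apply_apply_le ψ (f : Lp ℂ 2 arc)
    _ = ‖ψ‖ * ‖f‖ := by simp

/-- For `‖b‖ ≤ 1`, the operator `defect b` is a genuine square root of `I - T_b T_{b̄}`. -/
theorem defect_mul_self (b : HInf) (hb : ‖b‖ ≤ 1) :
    defect b * defect b = 1 - toeplitz (b : Lp ℂ ∞ arc) * toeplitz (star (b : Lp ℂ ∞ arc)) := by
  rw [defect, toeplitz_star]
  exact opSqrt_mul_self _ ((norm_toeplitz_le _).trans hb)

/-- The de Branges–Rovnyak space `H(b)`, i.e. the image of `H²` under `(I - T_b T_{b̄})^{1/2}`, as a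
set of functions on the disk (the values outside the disk are immaterial). -/
def deBrangesRovnyak (b : HInf) : Set (ℂ → ℂ) :=
  {f | ∃ h : Hardy2, h ∈ Set.range (defect b) ∧ Set.EqOn f (ext h) disk}

/-- The norm of `H(b)`, which makes `(I - T_b T_{b̄})^{1/2}` a partial isometry of `H²` onto `H(b)`:
the norm of `h` is the norm of its preimage orthogonal to the kernel. -/
def deBrangesRovnyakNorm (b : HInf) (h : Hardy2) : ℝ :=
  sInf (norm '' {g : Hardy2 | g ∈ (LinearMap.ker (defect b : Hardy2 →ₗ[ℂ] Hardy2))ᗮ ∧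
    defect b g = h})

theorem deBrangesRovnyakNorm_apply (b : HInf) (g : Hardy2)
    (hg : g ∈ (LinearMap.ker (defect b : Hardy2 →ₗ[ℂ] Hardy2))ᗮ) :
    deBrangesRovnyakNorm b (defect b g) = ‖g‖ := by
  have : {g' : Hardy2 | g' ∈ (LinearMap.ker (defect b : Hardy2 →ₗ[ℂ] Hardy2))ᗮ ∧
      defect b g' = defect b g} = {g} := by
    ext g'
    simp only [Set.mem_ofPred_eq, Set.mem_singleton_iff]
    refine ⟨fun ⟨h1, h2⟩ => ?_, fun h => ?_⟩
    swap
    · subst h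
      exact ⟨hg, rfl⟩
    have h3 : g' - g ∈ LinearMap.ker (defect b : Hardy2 →ₗ[ℂ] Hardy2) := by
      simp [LinearMap.mem_ker, h2]
    have h4 := Submodule.inner_right_of_mem_orthogonal h3 (Submodule.sub_mem _ h1 hg)
    exact sub_eq_zero.1 (inner_self_eq_zero.1 h4)
  rw [deBrangesRovnyakNorm, this]
  simp

/-! ### Weighted Dirichlet spaces -/

/-- Normalized area measure on the unit disk. -/
def area : Measure ℂ := ENNReal.ofReal (1 / Real.pi) • volume.restrict disk

/-- The weighted Dirichlet integral `∫ |f'|² ω dA`. -/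
def dirichletIntegral (ω : ℂ → ℝ) (f : ℂ → ℂ) : ℝ≥0∞ :=
  ∫⁻ z, ‖deriv f z‖ₑ ^ 2 * ENNReal.ofReal (ω z) ∂area

/-- The weighted Dirichlet space: holomorphic functions on the disk with finite Dirichlet integral
(the values outside the disk are immaterial). -/
def dirichletSpace (ω : ℂ → ℝ) : Set (ℂ → ℂ) :=
  {f | DifferentiableOn ℂ f disk ∧ dirichletIntegral ω f < ∞}

/-- The squared norm `‖h‖²_{H²} + ∫ |h'|² ω dA` of a function `h` of `H²`. -/
def dirichletNormSq (ω : ℂ → ℝ) (h : Hardy2) : ℝ≥0∞ :=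
  ENNReal.ofReal (‖h‖ ^ 2) + dirichletIntegral ω (ext h)

/-- `H(b) = D_ω` with equality of norms. -/
def EqualWithNorms (b : HInf) (ω : ℂ → ℝ) : Prop :=
  deBrangesRovnyak b = dirichletSpace ω ∧
    ∀ h : Hardy2, h ∈ Set.range (defect b) →
      ENNReal.ofReal (deBrangesRovnyakNorm b h ^ 2) = dirichletNormSq ω h

/-! ### Inner and outer functions, extreme points, pairs -/

/-- Inner functions: holomorphic functions from the disk to the closed disk whose radial limits
have modulus one almost everywhere. -/
def IsInner (θ : ℂ → ℂ) : Prop :=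
  DifferentiableOn ℂ θ disk ∧ (∀ z ∈ disk, ‖θ z‖ ≤ 1) ∧
    ∀ᵐ t ∂arc, ∃ w : ℂ, ‖w‖ = 1 ∧ Tendsto (fun r : ℝ => θ (r * pt t)) (𝓝[<] 1) (𝓝 w)

/-- Outer functions: `c exp (∫ (λ + z) / (λ - z) k(λ) |dλ|/2π)` with `|c| = 1` and `k` a real
integrable function on the circle. -/
def IsOuter (g : ℂ → ℂ) : Prop :=
  ∃ (c : ℂ) (k : Circ → ℝ), ‖c‖ = 1 ∧ Integrable k arc ∧
    ∀ z ∈ disk, g z = c * Complex.exp (∫ t, (pt t + z) / (pt t - z) * (k t : ℂ) ∂arc)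

/-- `θ` is the inner factor of `f` (inner factors are unique up to a unimodular constant):
`f = θ g` on the disk with `θ` inner and `g` outer. -/
def IsInnerFactor (θ f : ℂ → ℂ) : Prop :=
  IsInner θ ∧ ∃ g : ℂ → ℂ, IsOuter g ∧ ∀ z ∈ disk, f z = θ z * g z

/-- `b` is a non-extreme point of the closed unit ball of `H^∞`. -/
def NonExtreme (b : HInf) : Prop :=
  b ∈ Metric.closedBall (0 : HInf) 1 ∧ b ∉ (Metric.closedBall (0 : HInf) 1).extremePoints ℝ

/-- `(b, a)` is a pair: `a` is outer, `a(0) > 0` and `|a|² + |b|² = 1` a.e. on the circle. -/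
def IsPair (b a : HInf) : Prop :=
  IsOuter (ext (a : Lp ℂ ∞ arc)) ∧
    (0 < (ext (a : Lp ℂ ∞ arc) 0).re ∧ (ext (a : Lp ℂ ∞ arc) 0).im = 0) ∧
    ∀ᵐ t ∂arc, ‖(a : Lp ℂ ∞ arc) t‖ ^ 2 + ‖(b : Lp ℂ ∞ arc) t‖ ^ 2 = 1

end DBR

end

namespace DBR

open ComplexConjugate

/-! ### Fourier coefficients -/

/-! Everything comes from comparing the two norms with the norm of H². Write D for the defect
operator. Since ‖D g‖² = ‖g‖² - ‖T_b̄ g‖², an element of H(b) has H(b)-norm equal to its H²-norm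
exactly when T_b̄ kills it. On the Dirichlet side the same equality means that ∫ |f'|² ω dA = 0,
which forces f' = 0 because ω is not almost everywhere zero and the zeros of a nonzero holomorphic
function are countable. Hence the kernel of T_b̄ consists exactly of the constants.

That 1 lies in the kernel gives b(0) = 0 (`fourierCoeff_zero_eq_zero`); that z does not then gives
b'(0) ≠ 0 (`fourierCoeff_one_ne_zero`). Factor b/z = S h with S inner and h outer. The product b̄ S
equals the conjugate of z h on the circle, so T_b̄ S = 0 and S is constant; thus b is z times an
outer function (`ext_eq_mul_outer`).

For non-extremality, z = D g for some g, as ω is integrable. Cauchy–Schwarz gives |⟨z, b u⟩|² ≤ ‖g‖²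
∫ (1 - |b|²)|u|² for bounded analytic u (`norm_inner_toeplitz_sq_le`). The left side is |b'(0)
u(0)|². Taking |u|² = 1/(1 - |b|² + ε) bounds ∫ log(1 - |b|² + ε) from below uniformly in ε
(`le_integral_logReg_one_sub_norm_sq`), so log(1 - |b|²) is integrable. An outer a with |a|² = 1 -
|b|² then exists, and b ± a²/2 both lie in the unit ball. Finally, b/a is z times a quotient of
outer functions, again outer.

The function theory rests on `IsCompletion.exp`, which identifies exponentials of boundary functions
with exponentials of Herglotz transforms, and on `exists_outer`, which passes from regularized
logarithms to the logarithm itself. -/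

theorem norm_pt (t : Circ) : ‖pt t‖ = 1 := Circle.norm_coe _

theorem pt_ne_zero (t : Circ) : pt t ≠ 0 := by simp [pt]

@[fun_prop]
theorem continuous_pt : Continuous pt :=
  continuous_subtype_val.comp AddCircle.continuous_toCircle

theorem fourier_eq_pt_zpow (n : ℤ) (t : Circ) : (fourier n t : ℂ) = pt t ^ n := by
  simp [fourier_apply, AddCircle.toCircle_zsmul, pt]

theorem fourier_eq_pt_pow (n : ℕ) (t : Circ) : (fourier (n : ℤ) t : ℂ) = pt t ^ n := by
  rw [fourier_eq_pt_zpow, zpow_natCast]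

theorem norm_fourier_apply (n : ℤ) (t : Circ) : ‖(fourier n t : ℂ)‖ = 1 := by
  rw [fourier_apply]
  exact Circle.norm_coe _

theorem continuous_fourier (n : ℤ) : Continuous fun t : Circ => (fourier n t : ℂ) :=
  (fourier n).continuous

theorem norm_fourierCoeff_le (f : Circ → ℂ) (n : ℤ) : ‖fourierCoeff f n‖ ≤ ∫ t, ‖f t‖ ∂arc := by
  refine (norm_integral_le_integral_norm _).trans_eq ?_
  simp only [norm_smul, norm_fourier_apply, one_mul]

theorem fourierCoeff_fourier_mul (f : Circ → ℂ) (m n : ℤ) :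
    fourierCoeff (fun t => (fourier m t : ℂ) * f t) n = fourierCoeff f (n - m) := by
  simp only [fourierCoeff, smul_eq_mul, ← mul_assoc, ← fourier_add]
  congr! 5
  ring

theorem fourierCoeff_conj (f : Circ → ℂ) (n : ℤ) :
    fourierCoeff (fun t => conj (f t)) n = conj (fourierCoeff f (-n)) := by
  simp only [fourierCoeff, smul_eq_mul, neg_neg]
  rw [← integral_conj]
  simp

theorem fourierCoeff_sub {f g : Circ → ℂ} (hf : Integrable f arc) (hg : Integrable g arc) (n : ℤ) :
    fourierCoeff (fun t => f t - g t) n = fourierCoeff f n - fourierCoeff g n := by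
  simp only [fourierCoeff, smul_sub]
  exact integral_sub (hf.fourier_smul _) (hg.fourier_smul _)

theorem fourierCoeff_fourier_apply (m n : ℤ) :
    fourierCoeff (fun t : Circ => (fourier m t : ℂ)) n = if n = m then 1 else 0 := by
  have := congrFun (fourierCoeff_fourier (T := 1) m) n
  rw [Pi.single_apply] at this
  exact this

theorem fourierCoeff_const (c : ℂ) (n : ℤ) :
    fourierCoeff (fun _ : Circ => c) n = if n = 0 then c else 0 := by
  have h := fourierCoeff.const_mul (fun t : Circ => (fourier 0 t : ℂ)) c n
  rw [fourierCoeff_fourier_apply] at h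
  simpa using h

theorem fourierCoeff_eq_toLp {f : Circ → ℂ} (hf : MemLp f 2 arc) (n : ℤ) :
    fourierCoeff (hf.toLp f) n = fourierCoeff f n := by
  rw [fourierCoeff_congr_ae hf.coeFn_toLp]

theorem hasSum_sq_fourierCoeff_of_memLp {f : Circ → ℂ} (hf : MemLp f 2 arc) :
    HasSum (fun n => ‖fourierCoeff f n‖ ^ 2) (∫ t, ‖f t‖ ^ 2 ∂arc) := by
  have h := hasSum_sq_fourierCoeff (hf.toLp f)
  simp only [fourierCoeff_eq_toLp] at h
  rwa [integral_congr_ae (g := fun t => ‖f t‖ ^ 2)] at h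
  filter_upwards [hf.coeFn_toLp] with t ht
  rw [ht]

/-- Functions with equal Fourier coefficients agree almost everywhere. -/
theorem ae_eq_of_fourierCoeff_eq {f g : Circ → ℂ} (hf : MemLp f 2 arc) (hg : MemLp g 2 arc)
    (h : ∀ n, fourierCoeff f n = fourierCoeff g n) : f =ᵐ[arc] g := by
  have : hf.toLp f = hg.toLp g := by
    apply (fourierBasis (T := 1)).repr.injective
    ext n
    rw [fourierBasis_repr, fourierBasis_repr, fourierCoeff_eq_toLp, fourierCoeff_eq_toLp, h]
  filter_upwards [hf.coeFn_toLp, hg.coeFn_toLp] with t h1 h2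
  rw [← h1, ← h2, this]

/-- Every square-summable sequence is the sequence of Fourier coefficients of an `L²` function. -/
theorem exists_memLp_fourierCoeff_eq {c : ℤ → ℂ} (hc : Summable fun n => ‖c n‖ ^ 2) :
    ∃ f : Circ → ℂ, MemLp f 2 arc ∧ ∀ n, fourierCoeff f n = c n := by
  have h : Memℓp c 2 := memℓp_gen (by simpa using hc)
  refine ⟨(fourierBasis (T := 1)).repr.symm ⟨c, h⟩, Lp.memLp _, fun n => ?_⟩
  rw [← fourierBasis_repr]
  simp

/-- This is Parseval's identity for f and the n-th character times the conjugate of g: their inner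
product is the n-th coefficient of f g, and the products of coefficients are the terms of the
convolution. -/
theorem hasSum_fourierCoeff_mul {f g : Circ → ℂ} (hf : MemLp f 2 arc) (hg : MemLp g 2 arc)
    (n : ℤ) :
    HasSum (fun k => fourierCoeff f k * fourierCoeff g (n - k))
      (fourierCoeff (fun t => f t * g t) n) := by
  set x : Circ → ℂ := fun t => (fourier n t : ℂ) * conj (g t) with hx
  have hxm : MemLp x 2 arc := by
    refine hg.of_le ?_ (ae_of_all _ fun t => ?_)
    · exact (continuous_fourier n).aestronglyMeasurable.mul
        (Complex.continuous_conj.comp_aestronglyMeasurable hg.1)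
    · rw [hx, norm_mul, norm_fourier_apply, one_mul, RCLike.norm_conj]
  have h := (fourierBasis (T := 1)).hasSum_inner_mul_inner (hxm.toLp x) (hf.toLp f)
  have h1 : ∀ (y : Lp ℂ 2 arc) k, inner ℂ (fourierBasis k) y = fourierCoeff y k := fun y k => by
    rw [← HilbertBasis.repr_apply_apply, fourierBasis_repr]
  have h2 : ∀ k, inner ℂ (hxm.toLp x) (fourierBasis k) * inner ℂ (fourierBasis k) (hf.toLp f) =
      fourierCoeff f k * fourierCoeff g (n - k) := fun k => by
    rw [← inner_conj_symm, h1, h1, fourierCoeff_eq_toLp, fourierCoeff_eq_toLp, hx,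
      fourierCoeff_fourier_mul, fourierCoeff_conj]
    simp [mul_comm]
  rw [funext h2] at h
  suffices fourierCoeff (fun t => f t * g t) n = inner ℂ (hxm.toLp x) (hf.toLp f) from this ▸ h
  rw [L2.inner_def, fourierCoeff]
  refine integral_congr_ae ?_
  filter_upwards [hxm.coeFn_toLp, hf.coeFn_toLp] with t ht1 ht2
  rw [ht1, ht2]
  simp [hx]
  ring

/-! ### Bounded analytic functions on the circle -/

/-- Functions on the circle representing elements of `H^∞`. -/
structure BddAnalytic (f : Circ → ℂ) : Prop where
  aesm : AEStronglyMeasurable f arc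
  bdd : ∃ C : ℝ, ∀ᵐ t ∂arc, ‖f t‖ ≤ C
  neg : ∀ n : ℤ, n < 0 → fourierCoeff f n = 0

theorem BddAnalytic.memLp {f : Circ → ℂ} (hf : BddAnalytic f) (p : ℝ≥0∞) : MemLp f p arc :=
  let ⟨C, hC⟩ := hf.bdd
  MemLp.of_bound hf.aesm C hC

theorem BddAnalytic.integrable {f : Circ → ℂ} (hf : BddAnalytic f) : Integrable f arc :=
  memLp_one_iff_integrable.1 (hf.memLp 1)

theorem ae_norm_le_norm (b : HInf) : ∀ᵐ t ∂arc, ‖(b : Lp ℂ ∞ arc) t‖ ≤ ‖b‖ := by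
  filter_upwards [ae_le_eLpNormEssSup (f := (b : Lp ℂ ∞ arc)) (μ := arc)] with t ht
  rw [← eLpNorm_exponent_top] at ht
  have := ENNReal.toReal_mono (Lp.eLpNorm_ne_top (b : Lp ℂ ∞ arc)) ht
  rw [toReal_enorm] at this
  exact this

theorem BddAnalytic.coe (b : HInf) : BddAnalytic (b : Lp ℂ ∞ arc) where
  aesm := Lp.aestronglyMeasurable _
  bdd := ⟨‖b‖, ae_norm_le_norm b⟩
  neg := b.2

/-- If two indices have a negative sum, one of them is negative, so every term of the convolution
vanishes. -/
theorem BddAnalytic.fourierCoeff_mul_neg {f g : Circ → ℂ} (hf : BddAnalytic f) (hg : BddAnalytic g)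
    {n : ℤ} (hn : n < 0) : fourierCoeff (fun t => f t * g t) n = 0 := by
  refine (hasSum_fourierCoeff_mul (hf.memLp 2) (hg.memLp 2) n).unique ?_
  convert hasSum_zero with k
  rcases lt_or_ge k 0 with hk | hk
  · rw [hf.neg k hk, zero_mul]
  · rw [hg.neg (n - k) (by omega), mul_zero]

theorem BddAnalytic.mul {f g : Circ → ℂ} (hf : BddAnalytic f) (hg : BddAnalytic g) :
    BddAnalytic fun t => f t * g t where
  aesm := hf.aesm.mul hg.aesm
  bdd := by
    obtain ⟨C, hC⟩ := hf.bdd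
    obtain ⟨D, hD⟩ := hg.bdd
    refine ⟨C * D, ?_⟩
    filter_upwards [hC, hD] with t h1 h2
    rw [norm_mul]
    exact mul_le_mul h1 h2 (norm_nonneg _) ((norm_nonneg _).trans h1)
  neg := fun _ hn => hf.fourierCoeff_mul_neg hg hn

theorem BddAnalytic.fourierCoeff_mul_zero {f g : Circ → ℂ} (hf : BddAnalytic f)
    (hg : BddAnalytic g) :
    fourierCoeff (fun t => f t * g t) 0 = fourierCoeff f 0 * fourierCoeff g 0 := by
  refine (hasSum_fourierCoeff_mul (hf.memLp 2) (hg.memLp 2) 0).unique ?_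
  have := hasSum_ite_eq (0 : ℤ) (fourierCoeff f 0 * fourierCoeff g 0)
  convert this with k
  rcases lt_trichotomy k 0 with hk | hk | hk
  · rw [hf.neg k hk, zero_mul, if_neg hk.ne]
  · simp [hk]
  · rw [hg.neg (0 - k) (by omega), mul_zero, if_neg hk.ne']

theorem BddAnalytic.fourier (n : ℕ) : BddAnalytic fun t => (fourier (n : ℤ) t : ℂ) where
  aesm := (continuous_fourier _).aestronglyMeasurable
  bdd := ⟨1, ae_of_all _ fun t => (norm_fourier_apply _ t).le⟩
  neg := fun m hm => by rw [fourierCoeff_fourier_apply, if_neg (by omega)]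

/-! ### Power series -/

theorem fourierCoeff_tsum {c : ℕ → ℂ} (hc : Summable fun n => ‖c n‖) (m : ℤ) :
    fourierCoeff (fun t => ∑' n, c n * pt t ^ n) m = ∑' n : ℕ, if m = n then c n else 0 := by
  have hint : ∀ n : ℕ, Integrable (fun t : Circ => fourier (-m) t • (c n * pt t ^ n)) arc := fun n =>
    (Continuous.smul (continuous_fourier _) (by fun_prop)).integrable_of_hasCompactSupport
      (HasCompactSupport.of_compactSpace _)
  have h := hasSum_integral_of_summable_integral_norm hint
    (by simpa only [norm_smul, norm_fourier_apply, norm_mul, norm_pow, norm_pt, one_pow, one_mul,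
      mul_one, integral_const, probReal_univ, one_smul] using hc)
  rw [fourierCoeff]
  simp only [← tsum_const_smul'']
  rw [← h.tsum_eq]
  congr! 2 with n
  have := fourierCoeff.const_mul (fun t : Circ => (fourier (n : ℤ) t : ℂ)) (c n) m
  rw [fourierCoeff_fourier_apply] at this
  simp only [fourier_eq_pt_pow] at this
  rw [fourierCoeff] at this
  rw [this]
  simp

theorem fourierCoeff_tsum_nat {c : ℕ → ℂ} (hc : Summable fun n => ‖c n‖) (m : ℕ) :
    fourierCoeff (fun t => ∑' n, c n * pt t ^ n) m = c m := by
  rw [fourierCoeff_tsum hc, tsum_eq_single m]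
  · simp
  · intro n hn
    rw [if_neg (by exact_mod_cast hn.symm)]

theorem fourierCoeff_tsum_neg {c : ℕ → ℂ} (hc : Summable fun n => ‖c n‖) {m : ℤ} (hm : m < 0) :
    fourierCoeff (fun t => ∑' n, c n * pt t ^ n) m = 0 := by
  rw [fourierCoeff_tsum hc]
  convert tsum_zero with n
  rw [if_neg (by omega)]

theorem summable_norm_ext {f : Circ → ℂ} {z : ℂ} (hz : z ∈ disk) :
    Summable fun n : ℕ => ‖fourierCoeff f n * z ^ n‖ := by
  have hz' : ‖z‖ < 1 := by simpa using hz
  refine Summable.of_nonneg_of_le (fun _ => norm_nonneg _) (fun n => ?_)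
    ((summable_geometric_of_lt_one (norm_nonneg z) hz').mul_left (∫ t, ‖f t‖ ∂arc))
  rw [norm_mul, norm_pow]
  gcongr
  exact norm_fourierCoeff_le f n

theorem hasSum_ext (f : Circ → ℂ) {z : ℂ} (hz : z ∈ disk) :
    HasSum (fun n : ℕ => fourierCoeff f n * z ^ n) (ext f z) :=
  (summable_norm_ext hz).of_norm.hasSum

theorem differentiableOn_ext (f : Circ → ℂ) : DifferentiableOn ℂ (ext f) disk := by
  intro z hz
  have hz' : ‖z‖ < 1 := by simpa using hz
  obtain ⟨r, hr1, hr2⟩ := exists_between hz'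
  have hr0 : 0 ≤ r := (norm_nonneg z).trans hr1.le
  have h : DifferentiableOn ℂ (ext f) (Metric.ball 0 r) := by
    refine Complex.differentiableOn_tsum_of_summable_norm (u := fun n => (∫ t, ‖f t‖ ∂arc) * r ^ n)
      ((summable_geometric_of_lt_one hr0 hr2).mul_left _) (fun n => by fun_prop)
      Metric.isOpen_ball fun n w hw => ?_
    rw [norm_mul, norm_pow]
    have : ‖w‖ ≤ r := by simpa using (Metric.mem_ball.1 hw).le
    have h0 : 0 ≤ ∫ t, ‖f t‖ ∂arc := integral_nonneg fun t => norm_nonneg (f t)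
    gcongr
    exact norm_fourierCoeff_le f n
  exact ((h z (by simpa using hr1)).differentiableAt
    (Metric.isOpen_ball.mem_nhds (by simpa using hr1))).differentiableWithinAt

theorem ext_zero (f : Circ → ℂ) : ext f 0 = fourierCoeff f 0 := by
  rw [ext, tsum_eq_single 0]
  · simp
  · intro n hn
    simp [hn]

theorem ext_congr_ae {f g : Circ → ℂ} (h : f =ᵐ[arc] g) : ext f = ext g := by
  funext z
  rw [ext, ext, fourierCoeff_congr_ae h]

/-- A holomorphic function on the disk is given by an absolutely convergent power series. -/
theorem exists_hasSum_of_differentiableOn {F : ℂ → ℂ} (hF : DifferentiableOn ℂ F disk) :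
    ∃ c : ℕ → ℂ, ∀ z ∈ disk, HasSum (fun n => c n * z ^ n) (F z) := by
  refine ⟨fun n => (n.factorial : ℂ)⁻¹ * iteratedDeriv n F 0, fun z hz => ?_⟩
  have h := Complex.hasSum_taylorSeries_on_ball hF hz
  simp only [smul_eq_mul, sub_zero] at h
  simpa only [mul_comm, mul_left_comm] using h

/-- Uniqueness of the coefficients of power series. -/
theorem coeff_eq_of_hasSum {c d : ℕ → ℂ} {F : ℂ → ℂ}
    (hc : ∀ z ∈ disk, HasSum (fun n => c n * z ^ n) (F z))
    (hd : ∀ z ∈ disk, HasSum (fun n => d n * z ^ n) (F z)) (n : ℕ) : c n = d n := by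
  -- Both coefficient sequences are read off as Fourier coefficients of F on the circle of radius
  -- 1/2, where the series converge absolutely.
  have hr : ((1 / 2 : ℝ) : ℂ) ∈ disk := by simp; norm_num
  have h : ∀ {c : ℕ → ℂ}, (∀ z ∈ disk, HasSum (fun n => c n * z ^ n) (F z)) →
      fourierCoeff (fun t => F ((1 / 2 : ℝ) * pt t)) n = c n * (1 / 2 : ℝ) ^ n := fun {c} hc => by
    have hs : Summable fun n => ‖c n * ((1 / 2 : ℝ) : ℂ) ^ n‖ := (hc _ hr).summable.norm
    rw [← fourierCoeff_tsum_nat hs n]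
    congr 1
    funext t
    have ht : ((1 / 2 : ℝ) : ℂ) * pt t ∈ disk := by
      rw [mem_ball_zero_iff, norm_mul, norm_pt]; simpa using hr
    rw [← (hc _ ht).tsum_eq]
    simp only [mul_pow, mul_assoc]
  have := (h hc).symm.trans (h hd)
  simpa using this

/-! ### Convergence -/

theorem norm_toLp_sub_sq {f g : Circ → ℂ} (hf : MemLp f 2 arc) (hg : MemLp g 2 arc) :
    ‖hf.toLp f - hg.toLp g‖ ^ 2 = ∫ t, ‖f t - g t‖ ^ 2 ∂arc := by
  rw [← MemLp.toLp_sub]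
  have h : ((‖(hf.sub hg).toLp (f - g)‖ ^ 2 : ℝ) : ℂ) = ((∫ t, ‖f t - g t‖ ^ 2 ∂arc : ℝ) : ℂ) := by
    rw [Complex.ofReal_pow]
    refine (inner_self_eq_norm_sq_to_K (𝕜 := ℂ) ((hf.sub hg).toLp (f - g))).symm.trans ?_
    rw [L2.inner_def, ← integral_complex_ofReal]
    refine integral_congr_ae ?_
    filter_upwards [(hf.sub hg).coeFn_toLp] with t ht
    rw [ht, inner_self_eq_norm_sq_to_K]
    simp
  exact_mod_cast h

theorem exists_seq_tendsto_ae_of_toLp {f : ℕ → Circ → ℂ} {g : Circ → ℂ}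
    (hf : ∀ n, MemLp (f n) 2 arc) (hg : MemLp g 2 arc)
    (h : Tendsto (fun n => (hf n).toLp (f n)) atTop (𝓝 (hg.toLp g))) :
    ∃ ns : ℕ → ℕ, StrictMono ns ∧ ∀ᵐ t ∂arc, Tendsto (fun i => f (ns i) t) atTop (𝓝 (g t)) := by
  obtain ⟨ns, h1, h2⟩ := (tendstoInMeasure_of_tendsto_Lp h).exists_seq_tendsto_ae
  refine ⟨ns, h1, ?_⟩
  filter_upwards [h2, hg.coeFn_toLp, ae_all_iff.2 fun n => (hf n).coeFn_toLp] with t h3 h4 h5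
  simpa only [h4, h5] using h3

theorem tendsto_fourierCoeff {f : ℕ → Circ → ℂ} {g : Circ → ℂ} {C : ℝ}
    (hf : ∀ n, AEStronglyMeasurable (f n) arc) (hC : ∀ n, ∀ᵐ t ∂arc, ‖f n t‖ ≤ C)
    (h : ∀ᵐ t ∂arc, Tendsto (fun i => f i t) atTop (𝓝 (g t))) (m : ℤ) :
    Tendsto (fun i => fourierCoeff (f i) m) atTop (𝓝 (fourierCoeff g m)) := by
  refine tendsto_integral_of_dominated_convergence (fun _ => C)
    (fun n => (continuous_fourier _).aestronglyMeasurable.smul (hf n)) (integrable_const _)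
    (fun n => ?_) ?_
  · filter_upwards [hC n] with t ht
    rwa [norm_smul, norm_fourier_apply, one_mul]
  · filter_upwards [h] with t ht
    exact ht.const_smul _

theorem BddAnalytic.of_tendsto {f : ℕ → Circ → ℂ} {g : Circ → ℂ} {C : ℝ}
    (hf : ∀ n, BddAnalytic (f n)) (hC : ∀ n, ∀ᵐ t ∂arc, ‖f n t‖ ≤ C)
    (h : ∀ᵐ t ∂arc, Tendsto (fun i => f i t) atTop (𝓝 (g t))) : BddAnalytic g where
  aesm := aestronglyMeasurable_of_tendsto_ae atTop (fun n => (hf n).aesm) h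
  bdd := by
    refine ⟨C, ?_⟩
    filter_upwards [h, ae_all_iff.2 hC] with t h1 h2
    exact le_of_tendsto h1.norm (Eventually.of_forall h2)
  neg := fun m hm => by
    refine tendsto_nhds_unique (tendsto_fourierCoeff (fun n => (hf n).aesm) hC h m) ?_
    simp only [(hf _).neg m hm]
    exact tendsto_const_nhds

theorem tendsto_ext {f : ℕ → Circ → ℂ} {g : Circ → ℂ} {C : ℝ}
    (hf : ∀ n, AEStronglyMeasurable (f n) arc) (hC : ∀ n, ∀ᵐ t ∂arc, ‖f n t‖ ≤ C)
    (h : ∀ᵐ t ∂arc, Tendsto (fun i => f i t) atTop (𝓝 (g t))) {z : ℂ} (hz : z ∈ disk) :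
    Tendsto (fun i => ext (f i) z) atTop (𝓝 (ext g z)) := by
  have hz' : ‖z‖ < 1 := by simpa using hz
  refine tendsto_tsum_of_dominated_convergence (bound := fun n => C * ‖z‖ ^ n)
    ((summable_geometric_of_lt_one (norm_nonneg z) hz').mul_left C)
    (fun k => (tendsto_fourierCoeff hf hC h k).mul_const _) (Eventually.of_forall fun n k => ?_)
  rw [norm_mul, norm_pow]
  gcongr
  refine (norm_fourierCoeff_le _ _).trans ?_
  refine (integral_mono_of_nonneg (ae_of_all _ fun _ => norm_nonneg _) (integrable_const C)
    (hC n)).trans_eq ?_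
  simp

theorem hasSum_of_eq {ι : Type*} {f g : ι → ℂ} {a b : ℂ} (h : HasSum f a) (hf : ∀ i, g i = f i)
    (hab : b = a) : HasSum g b := by
  rw [funext hf, hab]
  exact h

/-! ### The Herglotz transform -/

/-- The Herglotz transform of a function on the circle. -/
noncomputable def herglotz (k : Circ → ℝ) (z : ℂ) : ℂ :=
  ∫ t, (pt t + z) / (pt t - z) * (k t : ℂ) ∂arc

theorem pt_sub_ne_zero (t : Circ) {z : ℂ} (hz : z ∈ disk) : pt t - z ≠ 0 := by
  intro h
  have := norm_pt t
  rw [sub_eq_zero.1 h] at this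
  simp [this] at hz

theorem hasSum_herglotzKernel (t : Circ) {z : ℂ} (hz : z ∈ disk) :
    HasSum (fun n : ℕ => (if n = 0 then 1 else 2) * z ^ n * (fourier (-(n : ℤ)) t : ℂ))
      ((pt t + z) / (pt t - z)) := by
  have hz' : ‖z / pt t‖ < 1 := by simpa [norm_div, norm_pt] using hz
  -- With q = z / pt t the kernel is 2/(1 - q) - 1, so the constant term is 1 and all later
  -- coefficients are 2.
  have h1 := ((hasSum_geometric_of_norm_lt_one hz').mul_left 2).sub
    (hasSum_ite_eq (0 : ℕ) (1 : ℂ))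
  refine hasSum_of_eq h1 (fun n => ?_) ?_
  · rw [fourier_eq_pt_zpow, zpow_neg, zpow_natCast, div_pow]
    split_ifs with h
    · subst h; norm_num
    · ring
  · have := pt_sub_ne_zero t hz
    have := pt_ne_zero t
    rw [one_sub_div this]
    field_simp
    ring

theorem hasSum_herglotz {k : Circ → ℝ} (hk : Integrable k arc) {z : ℂ} (hz : z ∈ disk) :
    HasSum (fun n : ℕ => (if n = 0 then 1 else 2) * fourierCoeff (fun t => (k t : ℂ)) n * z ^ n)
      (herglotz k z) := by
  have hz' : ‖z‖ < 1 := by simpa using hz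
  have hs := (summable_geometric_of_lt_one (norm_nonneg z) hz')
  have := hasSum_integral_of_dominated_convergence
    (F := fun (n : ℕ) t => (if n = 0 then 1 else 2) * z ^ n * (fourier (-(n : ℤ)) t : ℂ) * (k t : ℂ))
    (f := fun t => (pt t + z) / (pt t - z) * (k t : ℂ))
    (μ := arc) (fun n t => 2 * ‖z‖ ^ n * ‖k t‖) (fun n => ?_) (fun n => ?_) ?_ ?_ ?_
  · refine hasSum_of_eq this (fun n => ?_) rfl
    rw [fourierCoeff]
    simp only [smul_eq_mul, mul_assoc]
    rw [integral_const_mul, integral_const_mul]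
    ring
  · exact ((continuous_const.mul (continuous_fourier _)).aestronglyMeasurable).mul
      (Complex.continuous_ofReal.comp_aestronglyMeasurable hk.1)
  · refine ae_of_all _ fun t => ?_
    rw [norm_mul, norm_mul, norm_mul, norm_fourier_apply, mul_one, norm_pow, Complex.norm_real]
    gcongr
    split_ifs <;> simp
  · exact ae_of_all _ fun t => (hs.mul_left 2).mul_right _
  · simp only [tsum_mul_right, tsum_mul_left]
    exact hk.norm.const_mul _
  · exact ae_of_all _ fun t => (hasSum_herglotzKernel t hz).mul_right _

theorem integrable_herglotz {k : Circ → ℝ} (hk : Integrable k arc) {z : ℂ} (hz : z ∈ disk) :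
    Integrable (fun t => (pt t + z) / (pt t - z) * (k t : ℂ)) arc := by
  have hc : Continuous fun t => (pt t + z) / (pt t - z) :=
    (by fun_prop : Continuous fun t => pt t + z).div (by fun_prop) fun t => pt_sub_ne_zero t hz
  obtain ⟨C, hC⟩ := (isCompact_univ.image hc).isBounded.exists_norm_le
  refine hk.ofReal.bdd_mul (c := C) hc.aestronglyMeasurable (ae_of_all _ fun t => ?_)
  exact hC _ (mem_image_of_mem _ (mem_univ t))

theorem herglotz_sub {k l : Circ → ℝ} (hk : Integrable k arc) (hl : Integrable l arc) {z : ℂ}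
    (hz : z ∈ disk) : herglotz (fun t => k t - l t) z = herglotz k z - herglotz l z := by
  rw [herglotz, herglotz, herglotz, ← integral_sub (integrable_herglotz hk hz)
    (integrable_herglotz hl hz)]
  simp only [Complex.ofReal_sub, mul_sub]

theorem herglotz_const (c : ℝ) {z : ℂ} (hz : z ∈ disk) : herglotz (fun _ => c) z = c := by
  refine (hasSum_herglotz (integrable_const c) hz).unique ?_
  convert hasSum_ite_eq (0 : ℕ) (c : ℂ) with n
  rw [fourierCoeff_const]
  split_ifs with h1 h2 <;> simp_all

theorem herglotz_zero (k : Circ → ℝ) : herglotz k 0 = (∫ t, k t ∂arc : ℝ) := by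
  rw [herglotz, ← integral_complex_ofReal]
  simp [pt_ne_zero]

theorem re_herglotzKernel_nonneg (t : Circ) {z : ℂ} (hz : z ∈ disk) :
    0 ≤ ((pt t + z) / (pt t - z)).re := by
  have hz' : ‖z‖ ≤ 1 := by simpa using (Metric.mem_ball.1 hz).le
  have h1 : pt t * conj (pt t) = 1 := by
    rw [Complex.mul_conj, Complex.normSq_eq_norm_sq, norm_pt]; simp
  have h2 : (pt t).re * (pt t).re + (pt t).im * (pt t).im = 1 := by
    have := congrArg Complex.re h1
    simpa using this
  have h3 : z.re * z.re + z.im * z.im ≤ 1 := by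
    rw [← Complex.normSq_apply, Complex.normSq_eq_norm_sq]
    exact pow_le_one₀ (norm_nonneg _) hz'
  rw [Complex.div_re, ← add_div]
  refine div_nonneg ?_ (Complex.normSq_nonneg _)
  simp only [Complex.add_re, Complex.sub_re, Complex.add_im, Complex.sub_im]
  nlinarith

/-- The real part of the kernel is the Poisson kernel, which is nonnegative, and constants are
reproduced; apply this to M - k. -/
theorem re_herglotz_le {k : Circ → ℝ} (hk : Integrable k arc) {M : ℝ} (hM : ∀ᵐ t ∂arc, k t ≤ M)
    {z : ℂ} (hz : z ∈ disk) : (herglotz k z).re ≤ M := by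
  have h : 0 ≤ (herglotz (fun t => M - k t) z).re := by
    have hi : Integrable (fun t => (pt t + z) / (pt t - z) * ((M - k t : ℝ) : ℂ)) arc :=
      integrable_herglotz ((integrable_const M).sub hk) hz
    rw [herglotz, ← RCLike.re_eq_complex_re, ← integral_re hi]
    refine integral_nonneg_of_ae ?_
    filter_upwards [hM] with t ht
    rw [RCLike.re_eq_complex_re, Complex.re_mul_ofReal]
    exact mul_nonneg (re_herglotzKernel_nonneg t hz) (sub_nonneg.2 ht)
  rw [herglotz_sub (integrable_const M) hk hz, herglotz_const M hz] at h
  simpa using h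

theorem tendsto_herglotz {k : ℕ → Circ → ℝ} {l B : Circ → ℝ}
    (hk : ∀ n, Integrable (k n) arc) (hB : Integrable B arc)
    (hb : ∀ n, ∀ᵐ t ∂arc, ‖k n t‖ ≤ B t)
    (h : ∀ᵐ t ∂arc, Tendsto (fun n => k n t) atTop (𝓝 (l t))) {z : ℂ} (hz : z ∈ disk) :
    Tendsto (fun n => herglotz (k n) z) atTop (𝓝 (herglotz l z)) := by
  refine tendsto_integral_of_dominated_convergence
    (fun t => ‖(pt t + z) / (pt t - z) * (B t : ℂ)‖)
    (fun n => (integrable_herglotz (hk n) hz).1) (integrable_herglotz hB hz).norm (fun n => ?_) ?_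
  · filter_upwards [hb n] with t ht
    rw [norm_mul, norm_mul]
    gcongr
    rw [Complex.norm_real, Complex.norm_real]
    exact ht.trans (le_abs_self _)
  · filter_upwards [h] with t ht
    exact ((Complex.continuous_ofReal.tendsto _).comp ht).const_mul _

/-! ### Analytic completions and exponentials -/

/-- `v` is the boundary function of the Herglotz transform of `k`. -/
structure IsCompletion (k : Circ → ℝ) (v : Circ → ℂ) : Prop where
  integrable : Integrable k arc
  memLp : MemLp v 2 arc
  re : ∀ᵐ t ∂arc, (v t).re = k t
  neg : ∀ n : ℤ, n < 0 → fourierCoeff v n = 0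
  nat : ∀ n : ℕ, fourierCoeff v n =
    (if n = 0 then 1 else 2) * fourierCoeff (fun t => (k t : ℂ)) n

theorem IsCompletion.sub {k l : Circ → ℝ} {v u : Circ → ℂ} (h : IsCompletion k v)
    (h' : IsCompletion l u) : IsCompletion (fun t => k t - l t) (fun t => v t - u t) where
  integrable := h.integrable.sub h'.integrable
  memLp := h.memLp.sub h'.memLp
  re := by
    filter_upwards [h.re, h'.re] with t h1 h2
    simp [h1, h2]
  neg := fun n hn => by
    rw [fourierCoeff_sub (h.memLp.integrable one_le_two) (h'.memLp.integrable one_le_two),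
      h.neg n hn, h'.neg n hn, sub_zero]
  nat := fun n => by
    simp only [Complex.ofReal_sub]
    rw [fourierCoeff_sub (h.memLp.integrable one_le_two) (h'.memLp.integrable one_le_two),
      fourierCoeff_sub (f := fun t => (k t : ℂ)) (g := fun t => (l t : ℂ))
        h.integrable.ofReal h'.integrable.ofReal, h.nat, h'.nat]
    ring

theorem IsCompletion.neg' {k : Circ → ℝ} {v : Circ → ℂ} (h : IsCompletion k v) :
    IsCompletion (fun t => -k t) (fun t => -v t) := by
  have h0 : IsCompletion (fun _ => 0) (fun _ => 0) :=
    ⟨integrable_const _, memLp_const _, by simp, by simp [fourierCoeff], by simp [fourierCoeff]⟩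
  simpa using h0.sub h

/-- Discarding the negative coefficients of k and doubling the positive ones preserves square
summability. As k is real, its coefficients satisfy c(-n) = conj c(n), so v and 2k - conj v have
equal coefficients, which yields the real part of v. -/
theorem exists_isCompletion {k : Circ → ℝ} (hk : MemLp k 2 arc) : ∃ v, IsCompletion k v := by
  set c : ℤ → ℂ := fourierCoeff fun t => (k t : ℂ) with hc
  have hkc : MemLp (fun t => (k t : ℂ)) 2 arc := hk.ofReal
  have hs := (hasSum_sq_fourierCoeff_of_memLp hkc).summable
  have hc' : ∀ n, c (-n) = conj (c n) := fun n => by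
    have := fourierCoeff_conj (fun t => (k t : ℂ)) (-n)
    rw [neg_neg] at this
    rw [hc, ← this]
    simp
  obtain ⟨v, hv, hvc⟩ := exists_memLp_fourierCoeff_eq
    (c := fun n => if n < 0 then 0 else if n = 0 then c n else 2 * c n) (by
      refine Summable.of_nonneg_of_le (fun _ => sq_nonneg _) (fun n => ?_) (hs.mul_left 4)
      split_ifs
      · simp only [norm_zero]; nlinarith [sq_nonneg ‖c n‖]
      · nlinarith [sq_nonneg ‖c n‖]
      · rw [norm_mul, mul_pow]; norm_num [hc])
  refine ⟨v, hk.integrable one_le_two, hv, ?_, fun n hn => by rw [hvc, if_pos hn], fun n => ?_⟩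
  · have hcv : MemLp (fun t => conj (v t)) 2 arc := hv.star
    have h : (fun t => v t - (2 * k t - conj (v t))) =ᵐ[arc] fun _ => 0 := by
      have h2 : MemLp (fun t => 2 * (k t : ℂ) - conj (v t)) 2 arc := (hkc.const_mul 2).sub hcv
      refine ae_eq_of_fourierCoeff_eq (hv.sub h2) (memLp_const _) fun n => ?_
      rw [fourierCoeff_sub (hv.integrable one_le_two) (h2.integrable one_le_two),
        fourierCoeff_sub ((hkc.integrable one_le_two).const_mul 2) (hcv.integrable one_le_two),
        fourierCoeff.const_mul, fourierCoeff_conj, hvc, hvc, fourierCoeff_const, ← hc]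
      rcases lt_trichotomy n 0 with hn | rfl | hn
      · rw [if_pos hn, if_neg (by omega), if_neg (by omega), map_mul, hc']
        simp [Complex.conj_ofNat]
      · have := hc' 0
        simp only [neg_zero] at this ⊢
        simp only [lt_irrefl, if_true, if_false, ← this]
        ring
      · rw [if_neg hn.not_gt, if_neg hn.ne', if_pos (by omega)]
        simp
    filter_upwards [h] with t ht
    have := congrArg Complex.re ht
    simp at this
    linarith
  · rw [hvc, if_neg (by omega)]
    split_ifs <;> simp_all

theorem IsCompletion.ext_eq {k : Circ → ℝ} {v : Circ → ℂ} (h : IsCompletion k v) {z : ℂ}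
    (hz : z ∈ disk) : ext v z = herglotz k z := by
  rw [ext, ← (hasSum_herglotz h.integrable hz).tsum_eq]
  simp only [h.nat]

theorem tendsto_toLp_dilate {v : Circ → ℂ} (hv : MemLp v 2 arc)
    (hneg : ∀ n : ℤ, n < 0 → fourierCoeff v n = 0) {r : ℕ → ℝ} (hr0 : ∀ j, 0 ≤ r j)
    (hr1 : ∀ j, r j < 1) (hr : Tendsto r atTop (𝓝 1))
    (hm : ∀ j, MemLp (fun t => ext v (r j * pt t)) 2 arc) :
    Tendsto (fun j => (hm j).toLp) atTop (𝓝 (hv.toLp)) := by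
  -- The dilation multiplies the n-th coefficient by r^n, so Parseval turns the claim into dominated
  -- convergence of a series. For negative n the exponent `n.toNat` is 0, harmlessly, since those
  -- coefficients of v vanish.
  have hd : ∀ j, ((r j : ℝ) : ℂ) ∈ disk := fun j => by simpa [abs_of_nonneg (hr0 j)] using hr1 j
  have hcoef : ∀ j n, fourierCoeff (fun t => ext v (r j * pt t) - v t) n =
      fourierCoeff v n * ((r j : ℂ) ^ n.toNat - 1) := fun j n => by
    rw [fourierCoeff_sub ((hm j).integrable one_le_two) (hv.integrable one_le_two)]
    have h1 := fourierCoeff_tsum_nat (summable_norm_ext (f := v) (hd j))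
    have h2 := fun m => fourierCoeff_tsum_neg (summable_norm_ext (f := v) (hd j)) (m := m)
    have h3 : (fun t => ext v (r j * pt t)) =
        fun t => ∑' n : ℕ, fourierCoeff v n * (r j : ℂ) ^ n * pt t ^ n := by
      funext t
      simp only [ext, mul_pow, mul_assoc]
    rw [h3]
    rcases lt_or_ge n 0 with hn | hn
    · rw [h2 n hn, hneg n hn]; simp
    · lift n to ℕ using hn
      rw [h1, Int.toNat_natCast]
      ring
  rw [tendsto_iff_norm_sub_tendsto_zero]
  suffices h : Tendsto (fun j => ‖(hm j).toLp - hv.toLp‖ ^ 2) atTop (𝓝 0) by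
    simpa using h.sqrt
  simp only [norm_toLp_sub_sq]
  have h1 : ∀ j, ∫ t, ‖ext v (r j * pt t) - v t‖ ^ 2 ∂arc =
      ∑' n : ℤ, ‖fourierCoeff v n * ((r j : ℂ) ^ n.toNat - 1)‖ ^ 2 := fun j => by
    have := (hasSum_sq_fourierCoeff_of_memLp ((hm j).sub hv)).tsum_eq
    refine this.symm.trans (tsum_congr fun n => ?_)
    rw [← hcoef]
    rfl
  simp only [h1]
  rw [← tsum_zero (α := ℝ) (β := ℤ)]
  refine tendsto_tsum_of_dominated_convergence
    (hasSum_sq_fourierCoeff_of_memLp hv).summable (fun n => ?_)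
    (Eventually.of_forall fun j n => ?_)
  · have : Tendsto (fun j => ‖fourierCoeff v n * ((r j : ℂ) ^ n.toNat - 1)‖ ^ 2) atTop
        (𝓝 (‖fourierCoeff v n * (((1 : ℝ) : ℂ) ^ n.toNat - 1)‖ ^ 2)) :=
      (((((((Complex.continuous_ofReal.tendsto 1).comp hr).pow _).sub_const 1).const_mul
        _).norm).pow 2)
    simpa using this
  · rw [norm_pow, norm_norm, norm_mul, mul_pow]
    have h0 : ‖(r j : ℂ) ^ n.toNat - 1‖ ≤ 1 := by
      rw [← Complex.ofReal_pow, ← Complex.ofReal_one, ← Complex.ofReal_sub, Complex.norm_real,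
        Real.norm_eq_abs, abs_le]
      have := pow_le_one₀ (n := n.toNat) (hr0 j) (hr1 j).le
      have := pow_nonneg (hr0 j) n.toNat
      constructor <;> linarith
    exact mul_le_of_le_one_right (by positivity) (pow_le_one₀ (norm_nonneg _) h0)

/-- Exponentials of analytic completions of functions bounded above are bounded analytic
functions. -/
theorem IsCompletion.exp {k : Circ → ℝ} {v : Circ → ℂ} (h : IsCompletion k v) {M : ℝ}
    (hM : ∀ᵐ t ∂arc, k t ≤ M) :
    BddAnalytic (fun t => Complex.exp (v t)) ∧
      ∀ z ∈ disk, ext (fun t => Complex.exp (v t)) z = Complex.exp (herglotz k z) := by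
  -- On the circles of radius r j the exponential is an absolutely convergent power series bounded
  -- by exp M. Along a subsequence the dilates of v converge almost everywhere, and analyticity and
  -- coefficients pass to the limit by bounded convergence.
  set r : ℕ → ℝ := fun j => 1 - 1 / ((j : ℝ) + 1 + 1) with hrdef
  have hpos : ∀ j : ℕ, 0 < 1 / ((j : ℝ) + 1 + 1) := fun j => by positivity
  have hr0 : ∀ j, 0 ≤ r j := fun j => by
    rw [hrdef, sub_nonneg, div_le_one (by positivity)]
    linarith [(Nat.cast_nonneg j : (0 : ℝ) ≤ j)]
  have hr1 : ∀ j, r j < 1 := fun j => by linarith [hpos j]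
  have hr : Tendsto r atTop (𝓝 1) := by
    have := ((tendsto_one_div_add_atTop_nhds_zero_nat (𝕜 := ℝ)).comp
      (tendsto_add_atTop_nat 1)).const_sub 1
    simpa [hrdef, Function.comp_def] using this
  have hd : ∀ j, ((r j : ℝ) : ℂ) ∈ disk := fun j => by simpa [abs_of_nonneg (hr0 j)] using hr1 j
  have hdt : ∀ j t, (r j : ℂ) * pt t ∈ disk := fun j t => by
    rw [mem_ball_zero_iff, norm_mul, norm_pt, mul_one]; simpa using hd j
  have hcont : ∀ j, Continuous fun t => ext v (r j * pt t) := fun j =>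
    (differentiableOn_ext v).continuousOn.comp_continuous (by fun_prop) (hdt j)
  have hm : ∀ j, MemLp (fun t => ext v (r j * pt t)) 2 arc := fun j =>
    (hcont j).memLp_of_hasCompactSupport
    (HasCompactSupport.of_compactSpace _)
  obtain ⟨ns, hns0, hns⟩ := exists_seq_tendsto_ae_of_toLp hm h.memLp
    (tendsto_toLp_dilate h.memLp h.neg hr0 hr1 hr hm)
  have hF : DifferentiableOn ℂ (fun z => Complex.exp (ext v z)) disk := (differentiableOn_ext v).cexp
  obtain ⟨c, hc⟩ := exists_hasSum_of_differentiableOn hF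
  have hfun : ∀ j, (fun t => Complex.exp (ext v (r j * pt t))) =
      fun t => ∑' n, c n * (r j : ℂ) ^ n * pt t ^ n := fun j => by
    funext t
    rw [← (hc _ (hdt j t)).tsum_eq]
    simp only [mul_pow, mul_assoc]
  have hsum : ∀ j, Summable fun n => ‖c n * (r j : ℂ) ^ n‖ := fun j => (hc _ (hd j)).summable.norm
  have hbd : ∀ j t, ‖Complex.exp (ext v (r j * pt t))‖ ≤ Real.exp M := fun j t => by
    rw [Complex.norm_exp, h.ext_eq (hdt j t)]
    exact Real.exp_le_exp.2 (re_herglotz_le h.integrable hM (hdt j t))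
  have hB : ∀ j, BddAnalytic fun t => Complex.exp (ext v (r j * pt t)) := fun j =>
    ⟨(Complex.continuous_exp.comp (hcont j)).aestronglyMeasurable, ⟨_, ae_of_all _ (hbd j)⟩,
      fun m hm => by rw [hfun, fourierCoeff_tsum_neg (hsum j) hm]⟩
  have hlim : ∀ᵐ t ∂arc, Tendsto (fun i => Complex.exp (ext v (r (ns i) * pt t))) atTop
      (𝓝 (Complex.exp (v t))) := by
    filter_upwards [hns] with t ht
    exact (Complex.continuous_exp.tendsto _).comp ht
  refine ⟨BddAnalytic.of_tendsto (fun i => hB (ns i)) (fun i => ae_of_all _ (hbd (ns i))) hlim,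
    fun z hz => ?_⟩
  rw [← h.ext_eq hz, ← (hc z hz).tsum_eq, ext]
  refine tsum_congr fun n => ?_
  congr 1
  have h1 := tendsto_fourierCoeff (fun i => (hB (ns i)).aesm) (fun i => ae_of_all _ (hbd (ns i)))
    hlim n
  have h2 : Tendsto (fun i => c n * (r (ns i) : ℂ) ^ n) atTop (𝓝 (c n * ((1 : ℝ) : ℂ) ^ n)) :=
    (((Complex.continuous_ofReal.tendsto 1).comp (hr.comp hns0.tendsto_atTop)).pow n).const_mul _
  simp only [hfun, fourierCoeff_tsum_nat (hsum _)] at h1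
  simpa using tendsto_nhds_unique h1 h2

/-! ### Outer functions with prescribed modulus -/

/-- Regularization of the logarithm of the square root of a weight. -/
noncomputable def logReg (w : Circ → ℝ) (j : ℕ) (t : Circ) : ℝ :=
  Real.log (w t + 1 / ((j : ℝ) + 1)) / 2

theorem one_div_le_one_of_nat (j : ℕ) : 1 / ((j : ℝ) + 1) ≤ 1 := by
  rw [div_le_one (by positivity)]
  linarith [(Nat.cast_nonneg j : (0 : ℝ) ≤ j)]

theorem exp_logReg_sq {w : Circ → ℝ} {t : Circ} (h : 0 ≤ w t) (j : ℕ) :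
    Real.exp (logReg w j t) ^ 2 = w t + 1 / ((j : ℝ) + 1) := by
  rw [← Real.exp_nat_mul, logReg, Nat.cast_ofNat, mul_div_cancel₀ _ two_ne_zero,
    Real.exp_log (by positivity)]

theorem logReg_le {w : Circ → ℝ} {t : Circ} (h0 : 0 ≤ w t) (h1 : w t ≤ 1) (j : ℕ) :
    logReg w j t ≤ Real.log 2 / 2 := by
  rw [logReg]
  have : w t + 1 / ((j : ℝ) + 1) ≤ 2 := by linarith [one_div_le_one_of_nat j]
  gcongr

theorem le_logReg {w : Circ → ℝ} {t : Circ} (h0 : 0 ≤ w t) (j : ℕ) :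
    Real.log (1 / ((j : ℝ) + 1)) / 2 ≤ logReg w j t := by
  rw [logReg]
  gcongr
  linarith

theorem logReg_anti {w : Circ → ℝ} {t : Circ} (h0 : 0 ≤ w t) : Antitone fun j => logReg w j t := by
  intro i j hij
  simp only [logReg]
  gcongr

theorem tendsto_logReg {w : Circ → ℝ} {t : Circ} (h0 : 0 < w t) :
    Tendsto (fun j => logReg w j t) atTop (𝓝 (Real.log (w t) / 2)) := by
  have := (tendsto_one_div_add_atTop_nhds_zero_nat (𝕜 := ℝ)).const_add (w t)
  rw [add_zero] at this
  exact (this.log h0.ne').div_const 2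

/-- Measurable functions on the circle with values between zero and one. -/
structure IsWeight (w : Circ → ℝ) : Prop where
  aesm : AEStronglyMeasurable w arc
  nonneg : ∀ᵐ t ∂arc, 0 ≤ w t
  le_one : ∀ᵐ t ∂arc, w t ≤ 1

theorem memLp_logReg {w : Circ → ℝ} (hw : IsWeight w) (j : ℕ) (p : ℝ≥0∞) : MemLp (logReg w j) p arc := by
  refine MemLp.of_bound (C := max (Real.log 2 / 2) (-(Real.log (1 / ((j : ℝ) + 1)) / 2))) ?_ ?_
  · exact (Real.measurable_log.comp_aemeasurable
      (hw.aesm.aemeasurable.add_const _)).div_const 2 |>.aestronglyMeasurable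
  · filter_upwards [hw.nonneg, hw.le_one] with t ht0 ht1
    rw [Real.norm_eq_abs, abs_le']
    exact ⟨(logReg_le ht0 ht1 j).trans (le_max_left _ _),
      (neg_le_neg (le_logReg ht0 j)).trans (le_max_right _ _)⟩

theorem integrable_logReg {w : Circ → ℝ} (hw : IsWeight w) (j : ℕ) : Integrable (logReg w j) arc :=
  memLp_one_iff_integrable.1 (memLp_logReg hw j 1)

/-- Fatou's lemma for the nonnegative functions log 2 / 2 - `logReg w j`, whose integrals are
bounded by log 2 / 2 - C. Their limit is infinite wherever w vanishes, so that set is null. -/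
theorem integrable_log_of_le_integral_logReg {w : Circ → ℝ} (hw : IsWeight w) {C : ℝ}
    (hC : ∀ j, C ≤ ∫ t, logReg w j t ∂arc) :
    (∀ᵐ t ∂arc, 0 < w t) ∧ Integrable (fun t => Real.log (w t) / 2) arc := by
  set g : ℕ → Circ → ℝ := fun j t => Real.log 2 / 2 - logReg w j t with hg
  have hgi : ∀ j, Integrable (g j) arc := fun j =>
    (integrable_const _).sub (integrable_logReg hw j)
  have hg0 : ∀ j, 0 ≤ᵐ[arc] g j := fun j => by
    filter_upwards [hw.nonneg, hw.le_one] with t ht0 ht1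
    exact sub_nonneg.2 (logReg_le ht0 ht1 j)
  have hle : ∀ j, ∫⁻ t, ENNReal.ofReal (g j t) ∂arc ≤ ENNReal.ofReal (Real.log 2 / 2 - C) := fun j => by
    rw [← ofReal_integral_eq_lintegral_ofReal (hgi j) (hg0 j)]
    refine ENNReal.ofReal_le_ofReal ?_
    rw [hg, integral_sub (integrable_const _) (integrable_logReg hw j)]
    simpa only [integral_const, probReal_univ, one_smul, sub_le_sub_iff_left] using hC j
  have hfin : ∫⁻ t, liminf (fun j => ENNReal.ofReal (g j t)) atTop ∂arc < ∞ := by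
    refine (lintegral_liminf_le' fun j => (hgi j).1.aemeasurable.ennreal_ofReal).trans_lt ?_
    exact (liminf_le_of_frequently_le' (Eventually.frequently (Eventually.of_forall hle))).trans_lt
      ENNReal.ofReal_lt_top
  have hmeas : AEMeasurable (fun t => liminf (fun j => ENNReal.ofReal (g j t)) atTop) arc := by
    have H : ∀ j, AEMeasurable (fun t => ENNReal.ofReal (g j t)) arc := fun j =>
      (hgi j).1.aemeasurable.ennreal_ofReal
    refine ⟨fun t => liminf (fun j => (H j).mk _ t) atTop,
      Measurable.liminf fun j => (H j).measurable_mk, ?_⟩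
    filter_upwards [ae_all_iff.2 fun j => (H j).ae_eq_mk] with t ht
    exact congrArg (fun u => liminf u atTop) (funext ht)
  have hpos : ∀ᵐ t ∂arc, 0 < w t := by
    filter_upwards [hw.nonneg, ae_lt_top' hmeas hfin.ne] with t ht0 ht
    refine ht0.lt_of_ne' fun hwt => ht.ne ?_
    refine Tendsto.liminf_eq (ENNReal.tendsto_ofReal_nhds_top.2 ?_)
    have h2 : ∀ j, g j t = Real.log 2 / 2 + Real.log ((j : ℝ) + 1) / 2 := fun j => by
      simp only [hg, logReg, hwt, zero_add, one_div, Real.log_inv]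
      ring
    simp only [h2]
    refine tendsto_atTop_add_const_left _ _ (Tendsto.atTop_div_const two_pos ?_)
    exact Real.tendsto_log_atTop.comp
      (tendsto_atTop_add_const_right _ _ tendsto_natCast_atTop_atTop)
  refine ⟨hpos, ?_⟩
  have hlim : ∀ᵐ t ∂arc, liminf (fun j => ENNReal.ofReal (g j t)) atTop =
      ENNReal.ofReal (Real.log 2 / 2 - Real.log (w t) / 2) := by
    filter_upwards [hpos] with t ht
    exact ((ENNReal.continuous_ofReal.tendsto _).comp
      ((tendsto_logReg ht).const_sub _)).liminf_eq
  rw [lintegral_congr_ae hlim] at hfin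
  have hint : Integrable (fun t => Real.log 2 / 2 - Real.log (w t) / 2) arc := by
    refine ⟨((Real.measurable_log.comp_aemeasurable hw.aesm.aemeasurable).div_const
      2 |>.const_sub _).aestronglyMeasurable, ?_⟩
    rw [hasFiniteIntegral_iff_ofReal]
    · exact hfin
    · filter_upwards [hpos, hw.le_one] with t ht0 ht1
      have := Real.log_nonpos ht0.le ht1
      have := Real.log_nonneg one_le_two
      simp only [Pi.zero_apply]
      linarith
  refine ((integrable_const (Real.log 2 / 2)).sub hint).congr (ae_of_all _ fun t => ?_)
  simp

/-- From |e^v| ≤ 1 follows |e^v - 1|² ≤ 2 - 2 Re e^v, and the mean of e^v is its analytic extension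
at the origin, exp ∫ k. -/
theorem integral_norm_exp_sub_one_sq_le {k : Circ → ℝ} {v : Circ → ℂ} (hv : IsCompletion k v)
    (hk : ∀ᵐ t ∂arc, k t ≤ 0) :
    ∫ t, ‖Complex.exp (v t) - 1‖ ^ 2 ∂arc ≤ 2 - 2 * Real.exp (∫ t, k t ∂arc) := by
  obtain ⟨hb, he⟩ := hv.exp hk
  have h := he 0 (by simp)
  rw [ext_zero, herglotz_zero, ← Complex.ofReal_exp, fourierCoeff] at h
  simp only [neg_zero, fourier_zero, one_smul] at h
  have h2 : ∫ t, (Complex.exp (v t)).re ∂arc = Real.exp (∫ t, k t ∂arc) := by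
    have := integral_re hb.integrable
    simp only [RCLike.re_eq_complex_re] at this
    rw [this, h, Complex.ofReal_re]
  rw [← h2]
  have hre : Integrable (fun t => (Complex.exp (v t)).re) arc := hb.integrable.re
  calc ∫ t, ‖Complex.exp (v t) - 1‖ ^ 2 ∂arc ≤ ∫ t, (2 - 2 * (Complex.exp (v t)).re) ∂arc := by
        refine integral_mono_of_nonneg (ae_of_all _ fun _ => sq_nonneg _)
          ((integrable_const _).sub (hre.const_mul 2)) ?_
        filter_upwards [hk, hv.re] with t ht ht2
        have h3 : ‖Complex.exp (v t)‖ ^ 2 ≤ 1 := by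
          rw [Complex.norm_exp, ht2]
          exact pow_le_one₀ (Real.exp_pos _).le (Real.exp_le_one_iff.2 ht)
        rw [← Complex.normSq_eq_norm_sq, Complex.normSq_apply] at h3 ⊢
        simp only [Complex.sub_re, Complex.sub_im, Complex.one_re, Complex.one_im]
        nlinarith
    _ = 2 - 2 * ∫ t, (Complex.exp (v t)).re ∂arc := by
        rw [integral_sub (integrable_const _) (hre.const_mul 2), integral_const_mul]
        simp

theorem norm_exp_completion_sq {w : Circ → ℝ} (hw : IsWeight w) {v : ℕ → Circ → ℂ}
    (hv : ∀ j, IsCompletion (logReg w j) (v j)) (j : ℕ) :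
    ∀ᵐ t ∂arc, ‖Complex.exp (v j t)‖ ^ 2 = w t + 1 / ((j : ℝ) + 1) := by
  filter_upwards [(hv j).re, hw.nonneg] with t ht ht0
  rw [Complex.norm_exp, ht, exp_logReg_sq ht0]

/-- Factoring out e^(v i), whose squared modulus is at most 2, leaves e^(v j - v i) - 1, and the
exponent has nonpositive real part because the regularizations decrease. The bound makes the
exponentials Cauchy in L² once the integrals of `logReg` converge. -/
theorem integral_norm_exp_sub_exp_sq_le {w : Circ → ℝ} (hw : IsWeight w) {v : ℕ → Circ → ℂ}
    (hv : ∀ j, IsCompletion (logReg w j) (v j)) {i j : ℕ} (hij : i ≤ j) :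
    ∫ t, ‖Complex.exp (v i t) - Complex.exp (v j t)‖ ^ 2 ∂arc ≤
      4 - 4 * Real.exp (∫ t, logReg w j t ∂arc - ∫ t, logReg w i t ∂arc) := by
  have hq := (hv j).sub (hv i)
  have hq0 : ∀ᵐ t ∂arc, logReg w j t - logReg w i t ≤ 0 := by
    filter_upwards [hw.nonneg] with t ht
    exact sub_nonpos.2 (logReg_anti ht hij)
  have h := integral_norm_exp_sub_one_sq_le hq hq0
  rw [integral_sub (hv j).integrable (hv i).integrable] at h
  have hm : Integrable (fun t => ‖Complex.exp (v j t - v i t) - 1‖ ^ 2) arc :=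
    (((hq.exp hq0).1.memLp 2).sub (memLp_const 1)).integrable_norm_pow two_ne_zero
  calc ∫ t, ‖Complex.exp (v i t) - Complex.exp (v j t)‖ ^ 2 ∂arc
      ≤ ∫ t, 2 * ‖Complex.exp (v j t - v i t) - 1‖ ^ 2 ∂arc := by
        refine integral_mono_of_nonneg (ae_of_all _ fun _ => sq_nonneg _) (hm.const_mul 2) ?_
        filter_upwards [norm_exp_completion_sq hw hv i, hw.le_one] with t ht ht1
        have h2 : Complex.exp (v i t) - Complex.exp (v j t) =
            -(Complex.exp (v i t) * (Complex.exp (v j t - v i t) - 1)) := by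
          rw [Complex.exp_sub]
          field_simp [Complex.exp_ne_zero]
          ring
        simp only [h2, norm_neg, norm_mul, mul_pow, ht]
        gcongr
        linarith [one_div_le_one_of_nat i]
    _ ≤ _ := by
        rw [integral_const_mul]
        linarith

/-- A weight whose regularized logarithms have bounded integrals is log-integrable, and is the
squared modulus of a bounded outer function, which is a limit of exponentials. -/
theorem exists_outer {w : Circ → ℝ} (hw : IsWeight w) {v : ℕ → Circ → ℂ}
    (hv : ∀ j, IsCompletion (logReg w j) (v j)) {C : ℝ}
    (hC : ∀ j, C ≤ ∫ t, logReg w j t ∂arc) :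
    (∀ᵐ t ∂arc, 0 < w t) ∧ Integrable (fun t => Real.log (w t) / 2) arc ∧
      ∃ (h : Circ → ℂ) (ns : ℕ → ℕ), BddAnalytic h ∧
        (∀ᵐ t ∂arc, Tendsto (fun i => Complex.exp (v (ns i) t)) atTop (𝓝 (h t))) ∧
        (∀ᵐ t ∂arc, ‖h t‖ ^ 2 = w t) ∧
        ∀ z ∈ disk, ext h z = Complex.exp (herglotz (fun t => Real.log (w t) / 2) z) := by
  obtain ⟨hpos, hint⟩ := integrable_log_of_le_integral_logReg hw hC
  refine ⟨hpos, hint, ?_⟩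
  have hup : ∀ j, ∀ᵐ t ∂arc, logReg w j t ≤ Real.log 2 / 2 := fun j => by
    filter_upwards [hw.nonneg, hw.le_one] with t ht0 ht1
    exact logReg_le ht0 ht1 j
  have hb := fun j => ((hv j).exp (hup j)).1
  set I : ℕ → ℝ := fun j => ∫ t, logReg w j t ∂arc with hI
  have hanti : Antitone I := fun i j hij => by
    refine integral_mono_ae (hv j).integrable (hv i).integrable ?_
    filter_upwards [hw.nonneg] with t ht
    exact logReg_anti ht hij
  set L := ⨅ j, I j with hL
  have hbdd : BddBelow (range I) := ⟨C, by rintro _ ⟨j, rfl⟩; exact hC j⟩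
  have hIL : Tendsto I atTop (𝓝 L) := tendsto_atTop_ciInf hanti hbdd
  have hcau : CauchySeq fun j => ((hb j).memLp 2).toLp := by
    refine cauchySeq_of_le_tendsto_0' (fun i => √(4 - 4 * Real.exp (L - I i))) (fun i j hij => ?_) ?_
    · rw [dist_eq_norm]
      refine Real.le_sqrt_of_sq_le ?_
      rw [norm_toLp_sub_sq]
      refine (integral_norm_exp_sub_exp_sq_le hw hv hij).trans ?_
      have : L ≤ I j := ciInf_le hbdd j
      gcongr
    · have := (((hIL.const_sub L).rexp).const_mul 4).const_sub 4 |>.sqrt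
      simpa using this
  obtain ⟨h', hlim'⟩ := cauchySeq_tendsto_of_complete hcau
  have hh' : h' = (Lp.memLp h').toLp := (Lp.toLp_coeFn h' _).symm
  rw [hh'] at hlim'
  obtain ⟨ns, hns, hlim⟩ := exists_seq_tendsto_ae_of_toLp (fun j => (hb j).memLp 2) _ hlim'
  have hC2 : ∀ j, ∀ᵐ t ∂arc, ‖Complex.exp (v j t)‖ ≤ 2 := fun j => by
    filter_upwards [norm_exp_completion_sq hw hv j, hw.le_one] with t ht ht1
    have := one_div_le_one_of_nat j
    nlinarith [norm_nonneg (Complex.exp (v j t))]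
  refine ⟨h', ns, BddAnalytic.of_tendsto (fun i => hb (ns i)) (fun i => hC2 (ns i)) hlim, hlim,
    ?_, fun z hz => ?_⟩
  · filter_upwards [hlim, ae_all_iff.2 (norm_exp_completion_sq hw hv)] with t ht1 ht2
    have h3 : Tendsto (fun i => w t + 1 / ((ns i : ℝ) + 1)) atTop (𝓝 (w t + 0)) :=
      ((tendsto_one_div_add_atTop_nhds_zero_nat (𝕜 := ℝ)).comp hns.tendsto_atTop).const_add _
    have h4 := ht1.norm.pow 2
    simp only [ht2] at h4
    simpa using tendsto_nhds_unique h4 h3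
  · refine tendsto_nhds_unique (tendsto_ext (fun i => (hb (ns i)).aesm) (fun i => hC2 (ns i)) hlim hz) ?_
    simp only [((hv _).exp (hup _)).2 z hz]
    refine (Complex.continuous_exp.tendsto _).comp ?_
    -- Each regularized logarithm lies between log w / 2 and log 2 / 2, hence this dominating
    -- function.
    refine tendsto_herglotz (B := fun t => Real.log 2 / 2 + |Real.log (w t) / 2|)
      (fun i => (hv (ns i)).integrable) ((integrable_const _).add hint.abs) (fun i => ?_) ?_ hz
    · filter_upwards [hpos, hw.le_one] with t ht0 ht1
      have h3 := logReg_le ht0.le ht1 (ns i)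
      have h4 : Real.log (w t) / 2 ≤ logReg w (ns i) t := by
        rw [logReg]
        gcongr
        linarith [Nat.one_div_pos_of_nat (α := ℝ) (n := ns i)]
      have h5 := neg_abs_le (Real.log (w t) / 2)
      have h6 := abs_nonneg (Real.log (w t) / 2)
      have h7 := Real.log_nonneg one_le_two
      rw [Real.norm_eq_abs, abs_le]
      constructor <;> linarith
    · filter_upwards [hpos] with t ht
      exact (tendsto_logReg ht).comp hns.tendsto_atTop

/-! ### Elements of Hardy spaces and Toeplitz operators -/

/-- The element of `H²` represented by a bounded analytic function. -/
noncomputable def BddAnalytic.toHardy2 {f : Circ → ℂ} (hf : BddAnalytic f) : Hardy2 :=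
  ⟨(hf.memLp 2).toLp f, fun n hn => by rw [fourierCoeff_eq_toLp]; exact hf.neg n hn⟩

theorem BddAnalytic.coeFn_toHardy2 {f : Circ → ℂ} (hf : BddAnalytic f) :
    ((hf.toHardy2 : Lp ℂ 2 arc) : Circ → ℂ) =ᵐ[arc] f :=
  (hf.memLp 2).coeFn_toLp

theorem BddAnalytic.fourierCoeff_toHardy2 {f : Circ → ℂ} (hf : BddAnalytic f) (n : ℤ) :
    fourierCoeff (hf.toHardy2 : Lp ℂ 2 arc) n = fourierCoeff f n := by
  rw [fourierCoeff_congr_ae hf.coeFn_toHardy2]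

/-- The element of `H^∞` represented by a bounded analytic function. -/
noncomputable def BddAnalytic.toHInf {f : Circ → ℂ} (hf : BddAnalytic f) : HInf :=
  ⟨(hf.memLp ∞).toLp f, fun n hn => by
    rw [fourierCoeff_congr_ae (hf.memLp ∞).coeFn_toLp]; exact hf.neg n hn⟩

theorem BddAnalytic.coeFn_toHInf {f : Circ → ℂ} (hf : BddAnalytic f) :
    ((hf.toHInf : Lp ℂ ∞ arc) : Circ → ℂ) =ᵐ[arc] f :=
  (hf.memLp ∞).coeFn_toLp

theorem Hardy2.ext_fourierCoeff {f g : Hardy2}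
    (h : ∀ n : ℕ, fourierCoeff (f : Lp ℂ 2 arc) n = fourierCoeff (g : Lp ℂ 2 arc) n) : f = g := by
  refine Subtype.ext (Lp.ext (ae_eq_of_fourierCoeff_eq (Lp.memLp _) (Lp.memLp _) fun n => ?_))
  rcases lt_or_ge n 0 with hn | hn
  · rw [f.2 n hn, g.2 n hn]
  · lift n to ℕ using hn
    exact h n

theorem inner_fourier_toHardy2 (n : ℕ) (f : Hardy2) :
    inner ℂ (BddAnalytic.fourier n).toHardy2 f = fourierCoeff (f : Lp ℂ 2 arc) n := by
  rw [Submodule.coe_inner, L2.inner_def, fourierCoeff]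
  refine integral_congr_ae ?_
  filter_upwards [(BddAnalytic.fourier n).coeFn_toHardy2] with t ht
  rw [ht, fourier_neg, smul_eq_mul, mul_comm]
  rfl

theorem inner_self_Hardy2 (f : Hardy2) : inner ℂ f f = ((‖f‖ ^ 2 : ℝ) : ℂ) := by
  rw [Complex.ofReal_pow]
  exact inner_self_eq_norm_sq_to_K (𝕜 := ℂ) f

theorem norm_sq_Hardy2 (f : Hardy2) :
    ‖f‖ ^ 2 = ∫ t, ‖(f : Lp ℂ 2 arc) t‖ ^ 2 ∂arc := by
  have h := norm_toLp_sub_sq (Lp.memLp (f : Lp ℂ 2 arc)) (memLp_const 0)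
  have h0 : (memLp_const (0 : ℂ) : MemLp (fun _ : Circ => (0 : ℂ)) 2 arc).toLp = 0 := MemLp.toLp_zero _
  rw [h0, sub_zero, Lp.toLp_coeFn] at h
  simpa using h

theorem coeFn_mulOp (ψ : Lp ℂ ∞ arc) (f : Lp ℂ 2 arc) :
    (mulOp ψ f : Circ → ℂ) =ᵐ[arc] fun t => ψ t * f t :=
  (ContinuousLinearMap.mul ℂ ℂ).coeFn_holder (r := 2) ψ f

theorem fourierCoeff_toeplitz (ψ : Lp ℂ ∞ arc) (f : Hardy2) (n : ℕ) :
    fourierCoeff (toeplitz ψ f : Lp ℂ 2 arc) n =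
      fourierCoeff (fun t => ψ t * (f : Lp ℂ 2 arc) t) n := by
  rw [← inner_fourier_toHardy2, ← fourierCoeff_congr_ae (coeFn_mulOp ψ f)]
  simp only [toeplitz, ContinuousLinearMap.comp_apply, Submodule.subtypeL_apply]
  rw [Submodule.inner_orthogonalProjectionOnto_eq_of_mem_left, L2.inner_def, fourierCoeff]
  refine integral_congr_ae ?_
  filter_upwards [(BddAnalytic.fourier n).coeFn_toHardy2] with t ht
  rw [ht, fourier_neg, smul_eq_mul, mul_comm]
  rfl

theorem fourierCoeff_toeplitz_star (b : HInf) (f : Hardy2) (n : ℕ) :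
    fourierCoeff (toeplitz (star (b : Lp ℂ ∞ arc)) f : Lp ℂ 2 arc) n =
      fourierCoeff (fun t => conj ((b : Lp ℂ ∞ arc) t) * (f : Lp ℂ 2 arc) t) n := by
  rw [fourierCoeff_toeplitz]
  refine congrFun (fourierCoeff_congr_ae ?_) _
  filter_upwards [Lp.coeFn_star (b : Lp ℂ ∞ arc)] with t ht
  rw [ht]
  rfl

theorem toeplitz_star_eq_zero_iff (b : HInf) (f : Hardy2) :
    toeplitz (star (b : Lp ℂ ∞ arc)) f = 0 ↔
      ∀ n : ℕ, fourierCoeff (fun t => conj ((b : Lp ℂ ∞ arc) t) * (f : Lp ℂ 2 arc) t) n = 0 := by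
  simp only [← fourierCoeff_toeplitz_star]
  have h0 : ∀ n : ℕ, fourierCoeff ((0 : Hardy2) : Lp ℂ 2 arc) n = 0 := fun n => by
    rw [← inner_fourier_toHardy2, inner_zero_right]
  refine ⟨fun h n => by rw [h, h0], fun h => Hardy2.ext_fourierCoeff fun n => ?_⟩
  rw [h, h0]

/-- The Toeplitz operator of an analytic symbol is multiplication. -/
theorem toeplitz_toHardy2 (b : HInf) {u : Circ → ℂ} (hu : BddAnalytic u) :
    toeplitz (b : Lp ℂ ∞ arc) hu.toHardy2 = ((BddAnalytic.coe b).mul hu).toHardy2 := by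
  refine Hardy2.ext_fourierCoeff fun n => ?_
  rw [fourierCoeff_toeplitz, BddAnalytic.fourierCoeff_toHardy2]
  refine congrFun (fourierCoeff_congr_ae ?_) _
  filter_upwards [hu.coeFn_toHardy2] with t ht
  rw [ht]

/-! ### The defect operator -/

theorem inner_defect (b : HInf) (x y : Hardy2) : inner ℂ (defect b x) y = inner ℂ x (defect b y) :=
  ((ContinuousLinearMap.nonneg_iff_isPositive _).1 (opSqrt_nonneg _)).isSymmetric x y

theorem re_inner_defect_nonneg (b : HInf) (x : Hardy2) : 0 ≤ (inner ℂ (defect b x) x).re :=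
  ((ContinuousLinearMap.nonneg_iff_isPositive _).1
    (opSqrt_nonneg _ : 0 ≤ defect b)).re_inner_nonneg_left x

theorem inner_toeplitz_star (b : HInf) (x y : Hardy2) :
    inner ℂ (toeplitz (star (b : Lp ℂ ∞ arc)) x) y = inner ℂ x (toeplitz (b : Lp ℂ ∞ arc) y) := by
  rw [toeplitz_star, ContinuousLinearMap.star_eq_adjoint, ContinuousLinearMap.adjoint_inner_left]

theorem defect_defect {b : HInf} (hb : ‖b‖ ≤ 1) (f : Hardy2) :
    defect b (defect b f) =
      f - toeplitz (b : Lp ℂ ∞ arc) (toeplitz (star (b : Lp ℂ ∞ arc)) f) :=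
  congrArg (fun A : Hardy2 →L[ℂ] Hardy2 => A f) (defect_mul_self b hb)

theorem norm_defect_sq {b : HInf} (hb : ‖b‖ ≤ 1) (f : Hardy2) :
    ‖defect b f‖ ^ 2 = ‖f‖ ^ 2 - ‖toeplitz (star (b : Lp ℂ ∞ arc)) f‖ ^ 2 := by
  have h : (inner ℂ (defect b f) (defect b f) : ℂ) = inner ℂ f f -
      inner ℂ (toeplitz (star (b : Lp ℂ ∞ arc)) f) (toeplitz (star (b : Lp ℂ ∞ arc)) f) := by
    rw [inner_defect, defect_defect hb, inner_sub_right, inner_toeplitz_star]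
  rw [inner_self_Hardy2, inner_self_Hardy2, inner_self_Hardy2] at h
  exact_mod_cast h

/-- Here D²f = f, so D maps D f - f to its negative; positivity of D forces that vector to be zero.
-/
theorem defect_eq_self {b : HInf} (hb : ‖b‖ ≤ 1) {f : Hardy2}
    (hf : toeplitz (star (b : Lp ℂ ∞ arc)) f = 0) : defect b f = f := by
  have h1 : defect b (defect b f) = f := by rw [defect_defect hb, hf, map_zero, sub_zero]
  have h2 := re_inner_defect_nonneg b (defect b f - f)
  have h3 : defect b (defect b f - f) = -(defect b f - f) := by rw [map_sub, h1]; abel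
  rw [h3, inner_neg_left, inner_self_eq_norm_sq_to_K] at h2
  have h4 : ‖defect b f - f‖ ^ 2 ≤ 0 := by
    have : (0 : ℝ) ≤ -‖defect b f - f‖ ^ 2 := by
      convert h2 using 1
      norm_cast
    linarith
  exact sub_eq_zero.1 (norm_eq_zero.1 (pow_eq_zero_iff two_ne_zero |>.1 (h4.antisymm (sq_nonneg _))))

/-- Being fixed by the self-adjoint operator D, f is orthogonal to its kernel and is its own
norm-realizing preimage. -/
theorem deBrangesRovnyakNorm_eq_norm {b : HInf} (hb : ‖b‖ ≤ 1) {f : Hardy2}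
    (hf : toeplitz (star (b : Lp ℂ ∞ arc)) f = 0) : deBrangesRovnyakNorm b f = ‖f‖ := by
  have h := defect_eq_self hb hf
  conv_lhs => rw [← h]
  refine deBrangesRovnyakNorm_apply b f ?_
  rw [Submodule.mem_orthogonal]
  intro u hu
  rw [LinearMap.mem_ker] at hu
  rw [← h, ← inner_defect]
  exact (congrArg (fun x => inner ℂ x f) hu).trans (inner_zero_left _)

/-- Every element of `H(b)` is the image of a vector that realizes its norm. -/
theorem exists_defect_eq (b : HInf) {f : Hardy2} (hf : f ∈ Set.range (defect b)) :
    ∃ g, defect b g = f ∧ ‖g‖ = deBrangesRovnyakNorm b f := by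
  obtain ⟨g, rfl⟩ := hf
  set K := LinearMap.ker (defect b : Hardy2 →ₗ[ℂ] Hardy2) with hK
  have hclosed : IsClosed (K : Set Hardy2) := (defect b).isClosed_ker
  have : CompleteSpace K := hclosed.completeSpace_coe
  obtain ⟨y, hy, z, hz, hg⟩ := K.exists_add_mem_mem_orthogonal g
  have h : defect b z = defect b g := by
    rw [hg, map_add, show defect b y = 0 from hy, zero_add]
  exact ⟨z, h, by rw [← h, deBrangesRovnyakNorm_apply b z hz]⟩

/-- The norm-realizing preimage g satisfies ‖g‖ = ‖D g‖, so T_b̄ g = 0 by `norm_defect_sq`, and then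
f = D g = g. -/
theorem toeplitz_star_eq_zero_of_norm_eq {b : HInf} (hb : ‖b‖ ≤ 1) {f : Hardy2}
    (hf : f ∈ Set.range (defect b)) (hn : deBrangesRovnyakNorm b f = ‖f‖) :
    toeplitz (star (b : Lp ℂ ∞ arc)) f = 0 := by
  obtain ⟨g, rfl, hg⟩ := exists_defect_eq b hf
  rw [hn] at hg
  have h1 := norm_defect_sq hb g
  have h2 : toeplitz (star (b : Lp ℂ ∞ arc)) g = 0 := by
    rw [← hg, eq_comm, sub_eq_self] at h1
    exact norm_eq_zero.1 (pow_eq_zero_iff two_ne_zero |>.1 h1)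
  rw [defect_eq_self hb h2, h2]

/-- The estimate of Szegő type given by a vector `f = defect b g` of `H(b)`. -/
theorem norm_inner_toeplitz_sq_le {b : HInf} (hb : ‖b‖ ≤ 1) (g u : Hardy2) :
    ‖(inner ℂ (defect b g) (toeplitz (b : Lp ℂ ∞ arc) u) : ℂ)‖ ^ 2 ≤
      ‖g‖ ^ 2 * (‖u‖ ^ 2 - ‖toeplitz (b : Lp ℂ ∞ arc) u‖ ^ 2) := by
  set T := toeplitz (b : Lp ℂ ∞ arc) with hT
  set S := toeplitz (star (b : Lp ℂ ∞ arc)) with hS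
  have h1 : ‖(inner ℂ (defect b g) (T u) : ℂ)‖ ≤ ‖g‖ * ‖defect b (T u)‖ := by
    rw [inner_defect]
    exact norm_inner_le_norm (𝕜 := ℂ) g (defect b (T u))
  have h2 := norm_defect_sq hb (T u)
  have h3 : (inner ℂ (S (T u)) u : ℂ).re = ‖T u‖ ^ 2 := by
    rw [hS, inner_toeplitz_star, ← hT, inner_self_Hardy2, Complex.ofReal_re]
  -- Expanding ‖S T u - u‖² ≥ 0 bounds ‖D T u‖² = ‖T u‖² - ‖S T u‖² by ‖u‖² - ‖T u‖².
  have h4 : 0 ≤ ‖S (T u)‖ ^ 2 - 2 * ‖T u‖ ^ 2 + ‖u‖ ^ 2 := by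
    have := norm_sub_sq (𝕜 := ℂ) (S (T u)) u
    rw [RCLike.re_eq_complex_re, h3] at this
    rw [← this]
    positivity
  calc _ ≤ (‖g‖ * ‖defect b (T u)‖) ^ 2 := by gcongr
    _ = ‖g‖ ^ 2 * ‖defect b (T u)‖ ^ 2 := mul_pow _ _ _
    _ ≤ _ := by
      rw [h2]
      refine mul_le_mul_of_nonneg_left ?_ (sq_nonneg _)
      linarith

/-! ### The weighted Dirichlet integral -/

theorem ae_area_mem_disk : ∀ᵐ z ∂area, z ∈ disk :=
  Measure.ae_smul_measure (ae_restrict_mem Metric.isOpen_ball.measurableSet) _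

/-- If f' had only countably many zeros, these would be null and ω would vanish almost everywhere.
An uncountable zero set has an accumulation point within itself, so the identity theorem applies to
f'. -/
theorem deriv_eq_zero_of_dirichletIntegral_eq_zero {ω : ℂ → ℝ} (hω : ∀ᵐ z ∂area, 0 ≤ ω z)
    (hint : Integrable ω area) (hpos : 0 < ∫ z, ‖ω z‖ ∂area) {f : ℂ → ℂ}
    (hf : DifferentiableOn ℂ f disk) (h : dirichletIntegral ω f = 0) :
    ∀ z ∈ disk, deriv f z = 0 := by
  have hm : AEMeasurable (fun z => ‖deriv f z‖ₑ ^ 2 * ENNReal.ofReal (ω z)) area :=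
    ((measurable_deriv f).enorm.pow_const 2).aemeasurable.mul hint.1.aemeasurable.ennreal_ofReal
  rw [dirichletIntegral, lintegral_eq_zero_iff' hm] at h
  set Z := {z | z ∈ disk ∧ deriv f z = 0} with hZ
  have hunc : ¬ Z.Countable := by
    intro hc
    have h0 : area Z = 0 := by
      rw [area, Measure.smul_apply,
        le_antisymm ((Measure.restrict_apply_le _ _).trans_eq (hc.measure_zero volume)) zero_le]
      simp
    have h2 : (fun z => ‖ω z‖) =ᵐ[area] 0 := by
      filter_upwards [h, ae_area_mem_disk, hω, compl_mem_ae_iff.2 h0] with z h1 h2 h3 h4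
      have h5 : deriv f z ≠ 0 := fun h5 => h4 ⟨h2, h5⟩
      simp only [Pi.zero_apply, mul_eq_zero, pow_eq_zero_iff two_ne_zero, enorm_eq_zero, h5,
        false_or, ENNReal.ofReal_eq_zero] at h1
      simp [le_antisymm h1 h3]
    rw [integral_congr_ae h2] at hpos
    simp at hpos
  have han : AnalyticOnNhd ℂ (deriv f) disk := (hf.analyticOnNhd Metric.isOpen_ball).deriv
  obtain ⟨x, hx, hacc⟩ : ∃ x ∈ Z, AccPt x (𝓟 Z) := by
    by_contra! hno
    refine hunc ?_
    have : DiscreteTopology Z := by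
      rw [discreteTopology_subtype_iff]
      intro x hx
      exact not_neBot.1 (hno x hx)
    exact countable_coe_iff.1 (TopologicalSpace.separableSpace_iff_countable.1 inferInstance)
  rw [accPt_iff_frequently_nhdsNE] at hacc
  exact han.eqOn_zero_of_preconnected_of_frequently_eq_zero
    (convex_ball 0 1).isPreconnected hx.1 (hacc.mono fun z hz => hz.2)

theorem ext_eq_ext_zero {f : Circ → ℂ} (h : ∀ z ∈ disk, deriv (ext f) z = 0) :
    ∀ z ∈ disk, ext f z = ext f 0 := fun z hz =>
  Metric.isOpen_ball.is_const_of_deriv_eq_zero (convex_ball 0 1).isPreconnected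
    (differentiableOn_ext f) h hz (by simp)

theorem fourierCoeff_eq_zero_of_deriv_ext {f : Circ → ℂ} (h : ∀ z ∈ disk, deriv (ext f) z = 0)
    {n : ℕ} (hn : n ≠ 0) : fourierCoeff f n = 0 := by
  have := coeff_eq_of_hasSum (F := ext f) (c := fun n : ℕ => fourierCoeff f n)
    (d := fun n => if n = 0 then ext f 0 else 0) (fun z hz => hasSum_ext f hz) (fun z hz => ?_) n
  · simpa [hn] using this
  · rw [ext_eq_ext_zero h z hz]
    refine hasSum_of_eq (hasSum_ite_eq 0 (ext f 0)) (fun n => ?_) rfl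
    split_ifs with hn <;> simp [hn]

/-! ### Monomials in `H(b)` -/

/-- The monomial `zⁿ` as an element of `H²`. -/
noncomputable def monomial (n : ℕ) : Hardy2 := (BddAnalytic.fourier n).toHardy2

theorem fourierCoeff_monomial (n : ℕ) (m : ℤ) :
    fourierCoeff (monomial n : Lp ℂ 2 arc) m = if m = n then 1 else 0 := by
  rw [monomial, BddAnalytic.fourierCoeff_toHardy2, fourierCoeff_fourier_apply]

theorem ext_monomial (n : ℕ) : ext (monomial n : Lp ℂ 2 arc) = fun z => z ^ n := by
  funext z
  rw [ext, tsum_eq_single n]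
  · simp [fourierCoeff_monomial]
  · intro m hm
    rw [fourierCoeff_monomial, if_neg (by exact_mod_cast hm), zero_mul]

theorem pow_mem_dirichletSpace {ω : ℂ → ℝ} (hint : Integrable ω area) (n : ℕ) :
    (fun z : ℂ => z ^ n) ∈ dirichletSpace ω := by
  refine ⟨by fun_prop, ?_⟩
  have h : dirichletIntegral ω (fun z => z ^ n) ≤ ∫⁻ z, (n : ℝ≥0∞) ^ 2 * ‖ω z‖ₑ ∂area := by
    refine lintegral_mono_ae ?_
    filter_upwards [ae_area_mem_disk] with z hz
    have hz' : ‖z‖ ≤ 1 := by simpa using (Metric.mem_ball.1 hz).le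
    gcongr
    · rw [← ofReal_norm, ← ENNReal.ofReal_natCast]
      refine ENNReal.ofReal_le_ofReal ?_
      simp only [deriv_pow_field, norm_mul, norm_pow, Complex.norm_natCast]
      exact mul_le_of_le_one_right (Nat.cast_nonneg n) (pow_le_one₀ (norm_nonneg _) hz')
    · rw [← ofReal_norm]
      exact ENNReal.ofReal_le_ofReal (le_abs_self _)
  refine h.trans_lt ?_
  rw [lintegral_const_mul' _ _ (by finiteness)]
  exact ENNReal.mul_lt_top (by finiteness) hint.2

theorem monomial_mem_range_defect {b : HInf} {ω : ℂ → ℝ} (hint : Integrable ω area)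
    (heq : EqualWithNorms b ω) (n : ℕ) : monomial n ∈ Set.range (defect b) := by
  have h := pow_mem_dirichletSpace hint n
  rw [← heq.1] at h
  obtain ⟨f, hf, hfn⟩ := h
  suffices f = monomial n by rwa [← this]
  refine Hardy2.ext_fourierCoeff fun m => ?_
  refine coeff_eq_of_hasSum (c := fun m : ℕ => fourierCoeff (f : Lp ℂ 2 arc) m)
    (d := fun m : ℕ => fourierCoeff (monomial n : Lp ℂ 2 arc) m) (F := fun z => z ^ n)
    (fun z hz => ?_) (fun z hz => ?_) m
  · rw [show z ^ n = ext (f : Lp ℂ 2 arc) z from hfn hz]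
    exact hasSum_ext _ hz
  · have := hasSum_ext (monomial n : Lp ℂ 2 arc) hz
    rwa [ext_monomial] at this

theorem deriv_ext_eq_zero {b : HInf} (hb : ‖b‖ ≤ 1) {ω : ℂ → ℝ} (hω : ∀ᵐ z ∂area, 0 ≤ ω z)
    (hint : Integrable ω area) (hpos : 0 < ∫ z, ‖ω z‖ ∂area) (heq : EqualWithNorms b ω)
    {f : Hardy2} (hf : toeplitz (star (b : Lp ℂ ∞ arc)) f = 0) :
    ∀ z ∈ disk, deriv (ext (f : Lp ℂ 2 arc)) z = 0 := by
  refine deriv_eq_zero_of_dirichletIntegral_eq_zero hω hint hpos (differentiableOn_ext _) ?_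
  have h := heq.2 f ⟨f, defect_eq_self hb hf⟩
  rw [deBrangesRovnyakNorm_eq_norm hb hf, dirichletNormSq] at h
  exact (ENNReal.add_right_inj ENNReal.ofReal_ne_top).1 (h.symm.trans (add_zero _).symm)

/-- The constant 1 has zero Dirichlet integral, so its two norms agree and T_b̄ 1 = 0; the constant
coefficient of T_b̄ 1 is the conjugate of b(0). -/
theorem fourierCoeff_zero_eq_zero {b : HInf} (hb : ‖b‖ ≤ 1) {ω : ℂ → ℝ}
    (hint : Integrable ω area) (heq : EqualWithNorms b ω) :
    fourierCoeff (b : Lp ℂ ∞ arc) 0 = 0 := by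
  have hr := monomial_mem_range_defect hint heq 0
  have h := heq.2 _ hr
  have hd : dirichletIntegral ω (ext (monomial 0 : Lp ℂ 2 arc)) = 0 := by
    simp [ext_monomial, dirichletIntegral]
  rw [dirichletNormSq, hd, add_zero, ENNReal.ofReal_eq_ofReal_iff (sq_nonneg _) (sq_nonneg _)] at h
  obtain ⟨g, -, hg⟩ := exists_defect_eq b hr
  have hn : deBrangesRovnyakNorm b (monomial 0) = ‖monomial 0‖ :=
    (pow_left_inj₀ (hg ▸ norm_nonneg g) (norm_nonneg _) two_ne_zero).1 h
  have hz := (toeplitz_star_eq_zero_iff b _).1 (toeplitz_star_eq_zero_of_norm_eq hb hr hn) 0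
  have h2 : (fun t => conj ((b : Lp ℂ ∞ arc) t) * (monomial 0 : Lp ℂ 2 arc) t) =ᵐ[arc]
      fun t => conj ((b : Lp ℂ ∞ arc) t) := by
    filter_upwards [(BddAnalytic.fourier 0).coeFn_toHardy2] with t ht
    rw [monomial, ht]
    simp
  rw [fourierCoeff_congr_ae h2, fourierCoeff_conj] at hz
  simpa using hz

/-- The only coefficients of T_b̄ z that can be nonzero are the conjugates of b'(0) and b(0). If
both vanished, z would lie in the kernel, although its derivative is not zero. -/
theorem fourierCoeff_one_ne_zero {b : HInf} (hb : ‖b‖ ≤ 1) {ω : ℂ → ℝ} (hω : ∀ᵐ z ∂area, 0 ≤ ω z)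
    (hint : Integrable ω area) (hpos : 0 < ∫ z, ‖ω z‖ ∂area) (heq : EqualWithNorms b ω) :
    fourierCoeff (b : Lp ℂ ∞ arc) 1 ≠ 0 := by
  intro h1
  have h0 := fourierCoeff_zero_eq_zero hb hint heq
  have hz : toeplitz (star (b : Lp ℂ ∞ arc)) (monomial 1) = 0 := by
    rw [toeplitz_star_eq_zero_iff]
    intro n
    have h2 : (fun t => conj ((b : Lp ℂ ∞ arc) t) * (monomial 1 : Lp ℂ 2 arc) t) =ᵐ[arc]
        fun t => (fourier 1 t : ℂ) * conj ((b : Lp ℂ ∞ arc) t) := by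
      filter_upwards [(BddAnalytic.fourier 1).coeFn_toHardy2] with t ht
      rw [monomial, ht, mul_comm]
      rfl
    rw [fourierCoeff_congr_ae h2, fourierCoeff_fourier_mul, fourierCoeff_conj, map_eq_zero]
    rcases n with _ | _ | n
    · simpa using h1
    · simpa using h0
    · exact b.2 _ (by push_cast; omega)
  have := deriv_ext_eq_zero hb hω hint hpos heq hz 0 (by simp)
  rw [ext_monomial] at this
  simp at this

/-! ### Division by the inner factor -/

theorem fourierCoeff_divide (f : Circ → ℂ) (n : ℤ) :
    fourierCoeff (fun t => (fourier (-1) t : ℂ) * f t) n = fourierCoeff f (n + 1) := by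
  rw [fourierCoeff_fourier_mul, sub_neg_eq_add]

theorem BddAnalytic.divide {f : Circ → ℂ} (hf : BddAnalytic f) (h0 : fourierCoeff f 0 = 0) :
    BddAnalytic fun t => (_root_.fourier (-1) t : ℂ) * f t where
  aesm := (continuous_fourier _).aestronglyMeasurable.mul hf.aesm
  bdd := by simpa only [norm_mul, norm_fourier_apply, one_mul] using hf.bdd
  neg := fun n hn => by
    rw [fourierCoeff_divide]
    rcases (by omega : n + 1 < 0 ∨ n + 1 = 0) with h | h
    · exact hf.neg _ h
    · rw [h, h0]

theorem ext_eq_mul_ext_divide {f : Circ → ℂ} (h0 : fourierCoeff f 0 = 0) {z : ℂ} (hz : z ∈ disk) :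
    ext f z = z * ext (fun t => (fourier (-1) t : ℂ) * f t) z := by
  have h := (hasSum_ext (fun t => (fourier (-1) t : ℂ) * f t) hz).mul_left z
  have h' := hasSum_ext f hz
  rw [← hasSum_nat_add_iff' 1] at h'
  simp only [Finset.sum_range_one, Nat.cast_zero, h0, zero_mul, sub_zero] at h'
  refine h'.unique (hasSum_of_eq h (fun n => ?_) rfl)
  rw [fourierCoeff_divide, pow_succ]
  push_cast
  ring

theorem exists_isCompletion_logReg {w : Circ → ℝ} (hw : IsWeight w) :
    ∃ v : ℕ → Circ → ℂ, ∀ j, IsCompletion (logReg w j) (v j) := by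
  choose v hv using fun j => exists_isCompletion (memLp_logReg hw j 2)
  exact ⟨v, hv⟩

/-- The regularization bounds the logarithm from below, so the reciprocal exponential is bounded
too. It serves as an approximate reciprocal of the outer function. -/
theorem bddAnalytic_exp_neg {w : Circ → ℝ} (hw : IsWeight w) {v : ℕ → Circ → ℂ}
    (hv : ∀ j, IsCompletion (logReg w j) (v j)) (j : ℕ) :
    BddAnalytic (fun t => Complex.exp (-v j t)) ∧
      fourierCoeff (fun t => Complex.exp (-v j t)) 0 =
        (Real.exp (-∫ t, logReg w j t ∂arc) : ℝ) := by
  have h := (hv j).neg'.exp (M := -(Real.log (1 / ((j : ℝ) + 1)) / 2)) (by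
    filter_upwards [hw.nonneg] with t ht
    exact neg_le_neg (le_logReg ht j))
  refine ⟨h.1, ?_⟩
  have := h.2 0 (by simp)
  rw [ext_zero, herglotz_zero, integral_neg] at this
  rw [this, Complex.ofReal_exp]

theorem norm_exp_neg_completion_sq {w : Circ → ℝ} (hw : IsWeight w) {v : ℕ → Circ → ℂ}
    (hv : ∀ j, IsCompletion (logReg w j) (v j)) (j : ℕ) :
    ∀ᵐ t ∂arc, w t * ‖Complex.exp (-v j t)‖ ^ 2 ≤ 1 := by
  filter_upwards [norm_exp_completion_sq hw hv j, hw.nonneg] with t ht ht0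
  have hj : 0 < 1 / ((j : ℝ) + 1) := Nat.one_div_pos_of_nat
  rw [Complex.exp_neg, norm_inv, inv_pow, ht, ← div_eq_mul_inv, div_le_one (by linarith)]
  linarith

theorem isWeight_norm_sq {f : Circ → ℂ} (hf : AEStronglyMeasurable f arc)
    (h : ∀ᵐ t ∂arc, ‖f t‖ ≤ 1) : IsWeight fun t => ‖f t‖ ^ 2 where
  aesm := (hf.norm.pow 2)
  nonneg := ae_of_all _ fun _ => sq_nonneg _
  le_one := by
    filter_upwards [h] with t ht
    exact pow_le_one₀ (norm_nonneg _) ht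

/-- Inner-outer factorization of a function in the unit ball that does not vanish at the
origin. -/
theorem BddAnalytic.exists_inner_mul_outer {f : Circ → ℂ} (hf : BddAnalytic f)
    (h1 : ∀ᵐ t ∂arc, ‖f t‖ ≤ 1) (h0 : fourierCoeff f 0 ≠ 0) :
    ∃ (S h : Circ → ℂ) (k : Circ → ℝ), BddAnalytic S ∧ BddAnalytic h ∧ Integrable k arc ∧
      (∀ᵐ t ∂arc, ‖S t‖ = 1) ∧ (∀ᵐ t ∂arc, f t = S t * h t) ∧
      ∀ z ∈ disk, ext h z = Complex.exp (herglotz k z) := by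
  have hw := isWeight_norm_sq hf.aesm h1
  obtain ⟨v, hv⟩ := exists_isCompletion_logReg hw
  have he := bddAnalytic_exp_neg hw hv
  have hS1 : ∀ j, ∀ᵐ t ∂arc, ‖f t * Complex.exp (-v j t)‖ ≤ 1 := fun j => by
    filter_upwards [norm_exp_neg_completion_sq hw hv j] with t ht
    rw [← mul_pow, ← norm_mul] at ht
    exact (pow_le_one_iff_of_nonneg (norm_nonneg _) two_ne_zero).1 ht
  -- Jensen's inequality: the product f e^(-v j) has modulus at most 1 on the circle, hence also at
  -- the origin, where it is the product of the values of its factors.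
  have hC : ∀ j, Real.log ‖fourierCoeff f 0‖ ≤ ∫ t, logReg (fun t => ‖f t‖ ^ 2) j t ∂arc := fun j => by
    have h2 : ‖fourierCoeff (fun t => f t * Complex.exp (-v j t)) 0‖ ≤ 1 := by
      refine (norm_fourierCoeff_le _ _).trans ((integral_mono_of_nonneg
        (ae_of_all _ fun _ => norm_nonneg _) (integrable_const 1) (hS1 j)).trans_eq (by simp))
    rw [hf.fourierCoeff_mul_zero (he j).1, (he j).2, norm_mul, Complex.norm_real, Real.norm_eq_abs,
      Real.abs_exp, Real.exp_neg, ← div_eq_mul_inv, div_le_one (Real.exp_pos _)] at h2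
    rw [Real.log_le_iff_le_exp (norm_pos_iff.2 h0)]
    exact h2
  obtain ⟨hpos, hint, h, ns, hh, hlim, hnorm, hext⟩ := exists_outer hw hv hC
  have hh0 : ∀ᵐ t ∂arc, ‖f t‖ = ‖h t‖ ∧ h t ≠ 0 := by
    filter_upwards [hpos, hnorm] with t ht1 ht2
    refine ⟨((pow_left_inj₀ (norm_nonneg _) (norm_nonneg _) two_ne_zero).1 ht2).symm, fun h3 => ?_⟩
    rw [← ht2, h3] at ht1
    simp at ht1
  refine ⟨fun t => f t / h t, h, _, ?_, hh, hint, ?_, ?_, hext⟩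
  · refine BddAnalytic.of_tendsto (f := fun i t => f t * Complex.exp (-v (ns i) t)) (C := 1)
      (fun i => hf.mul (he (ns i)).1) (fun i => hS1 (ns i)) ?_
    filter_upwards [hlim, hh0] with t ht1 ht2
    simp only [Complex.exp_neg, ← div_eq_mul_inv]
    exact tendsto_const_nhds.div ht1 ht2.2
  · filter_upwards [hh0] with t ht
    rw [norm_div, ht.1, div_self (norm_ne_zero_iff.2 ht.2)]
  · filter_upwards [hh0] with t ht
    rw [div_mul_cancel₀ _ ht.2]

/-- If `H(b) = D_ω`, then `b` is `z` times an outer function. -/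
theorem ext_eq_mul_outer {b : HInf} (hb : ‖b‖ ≤ 1) {ω : ℂ → ℝ} (hω : ∀ᵐ z ∂area, 0 ≤ ω z)
    (hint : Integrable ω area) (hpos : 0 < ∫ z, ‖ω z‖ ∂area) (heq : EqualWithNorms b ω) :
    ∃ (c : ℂ) (k : Circ → ℝ), ‖c‖ = 1 ∧ Integrable k arc ∧
      ∀ z ∈ disk, ext (b : Lp ℂ ∞ arc) z = z * (c * Complex.exp (herglotz k z)) := by
  have h0 := fourierCoeff_zero_eq_zero hb hint heq
  have hb1 := (BddAnalytic.coe b).divide h0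
  obtain ⟨S, h, k, hS, hh, hk, hS1, hfac, hext⟩ := hb1.exists_inner_mul_outer (by
    filter_upwards [ae_norm_le_norm b] with t ht
    rw [norm_mul, norm_fourier_apply, one_mul]
    exact ht.trans hb) (by
    rw [fourierCoeff_divide, zero_add]
    exact fourierCoeff_one_ne_zero hb hω hint hpos heq)
  -- As |S| = 1, conj b · S is the conjugate of z h, which has only negative frequencies.
  have hker : toeplitz (star (b : Lp ℂ ∞ arc)) hS.toHardy2 = 0 := by
    rw [toeplitz_star_eq_zero_iff]
    intro n
    have h2 : (fun t => conj ((b : Lp ℂ ∞ arc) t) * (hS.toHardy2 : Lp ℂ 2 arc) t) =ᵐ[arc]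
        fun t => conj ((fourier 1 t : ℂ) * h t) := by
      filter_upwards [hS.coeFn_toHardy2, hfac, hS1] with t ht1 ht2 ht3
      have h3 : (b : Lp ℂ ∞ arc) t = (fourier 1 t : ℂ) * (S t * h t) := by
        rw [← ht2, ← mul_assoc, ← fourier_add]
        simp
      have h4 : conj (S t) * S t = 1 := by
        rw [mul_comm, Complex.mul_conj, Complex.normSq_eq_norm_sq, ht3]
        simp
      rw [ht1, h3]
      simp only [map_mul]
      linear_combination (conj (fourier 1 t : ℂ) * conj (h t)) * h4
    rw [fourierCoeff_congr_ae h2, fourierCoeff_conj, fourierCoeff_fourier_mul,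
      hh.neg _ (by omega), map_zero]
  have hcoef : ∀ n : ℕ, n ≠ 0 → fourierCoeff S n = 0 := fun n hn => by
    rw [← hS.fourierCoeff_toHardy2]
    exact fourierCoeff_eq_zero_of_deriv_ext (deriv_ext_eq_zero hb hω hint hpos heq hker) hn
  have hconst : S =ᵐ[arc] fun _ => fourierCoeff S 0 := by
    refine ae_eq_of_fourierCoeff_eq (hS.memLp 2) (memLp_const _) fun n => ?_
    rw [fourierCoeff_const]
    rcases lt_or_ge n 0 with hn | hn
    · rw [hS.neg n hn, if_neg hn.ne]
    · lift n to ℕ using hn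
      split_ifs with h3
      · rw [h3]
      · exact hcoef n (by exact_mod_cast h3)
  refine ⟨fourierCoeff S 0, k, ?_, hk, fun z hz => ?_⟩
  · obtain ⟨t, ht1, ht2⟩ := (hconst.and hS1).exists
    exact (congrArg norm ht1).symm.trans ht2
  · have h2 : (fun t => (fourier (-1) t : ℂ) * (b : Lp ℂ ∞ arc) t) =ᵐ[arc]
        fun t => fourierCoeff S 0 * h t := by
      filter_upwards [hfac, hconst] with t ht1 ht2
      rw [ht1, ht2]
    rw [ext_eq_mul_ext_divide h0 hz, ext_congr_ae h2, ← hext z hz, ext, ext]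
    simp only [fourierCoeff.const_mul, mul_assoc, tsum_mul_left]

/-! ### The Pythagorean mate and non-extremality -/

theorem isWeight_one_sub_norm_sq {b : HInf} (hb : ‖b‖ ≤ 1) :
    IsWeight fun t => 1 - ‖(b : Lp ℂ ∞ arc) t‖ ^ 2 where
  aesm := aestronglyMeasurable_const.sub ((BddAnalytic.coe b).aesm.norm.pow 2)
  nonneg := by
    filter_upwards [ae_norm_le_norm b] with t ht
    exact sub_nonneg.2 (pow_le_one₀ (norm_nonneg _) (ht.trans hb))
  le_one := ae_of_all _ fun t => sub_le_self _ (sq_nonneg _)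

/-- The Szegő-type estimate for z = D g is tested on u = e^(-v j), with |u|² the reciprocal of the
regularized weight. Then (1 - |b|²)|u|² ≤ 1, so |b'(0)| u(0) ≤ ‖g‖ with u(0) = exp(-∫ `logReg`). -/
theorem le_integral_logReg_one_sub_norm_sq {b : HInf} (hb : ‖b‖ ≤ 1) {ω : ℂ → ℝ}
    (hω : ∀ᵐ z ∂area, 0 ≤ ω z) (hint : Integrable ω area) (hpos : 0 < ∫ z, ‖ω z‖ ∂area)
    (heq : EqualWithNorms b ω) :
    ∃ C, ∀ j, C ≤ ∫ t, logReg (fun t => 1 - ‖(b : Lp ℂ ∞ arc) t‖ ^ 2) j t ∂arc := by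
  have h0 := fourierCoeff_zero_eq_zero hb hint heq
  have h1 := fourierCoeff_one_ne_zero hb hω hint hpos heq
  have hw := isWeight_one_sub_norm_sq hb
  obtain ⟨v, hv⟩ := exists_isCompletion_logReg hw
  obtain ⟨g, hg⟩ := monomial_mem_range_defect hint heq 1
  refine ⟨Real.log (‖fourierCoeff (b : Lp ℂ ∞ arc) 1‖ / ‖g‖), fun j => ?_⟩
  obtain ⟨hu, hu0⟩ := bddAnalytic_exp_neg hw hv j
  have hbu := (BddAnalytic.coe b).mul hu
  have h2 : ‖hu.toHardy2‖ ^ 2 - ‖toeplitz (b : Lp ℂ ∞ arc) hu.toHardy2‖ ^ 2 ≤ 1 := by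
    rw [toeplitz_toHardy2, norm_sq_Hardy2, norm_sq_Hardy2, ← integral_sub
      ((Lp.memLp _).integrable_norm_pow two_ne_zero) ((Lp.memLp _).integrable_norm_pow two_ne_zero)]
    refine (integral_mono_ae (((Lp.memLp _).integrable_norm_pow two_ne_zero).sub
      ((Lp.memLp _).integrable_norm_pow two_ne_zero)) (integrable_const 1) ?_).trans_eq (by simp)
    filter_upwards [hu.coeFn_toHardy2, hbu.coeFn_toHardy2,
      norm_exp_neg_completion_sq hw hv j] with t ht1 ht2 ht3
    change ‖(hu.toHardy2 : Lp ℂ 2 arc) t‖ ^ 2 - ‖(hbu.toHardy2 : Lp ℂ 2 arc) t‖ ^ 2 ≤ 1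
    rw [ht1, ht2, norm_mul, mul_pow]
    linarith
  have h3 : inner ℂ (defect b g) (toeplitz (b : Lp ℂ ∞ arc) hu.toHardy2) =
      fourierCoeff (b : Lp ℂ ∞ arc) 1 *
        (Real.exp (-∫ t, logReg (fun t => 1 - ‖(b : Lp ℂ ∞ arc) t‖ ^ 2) j t ∂arc) : ℝ) := by
    rw [hg, monomial, inner_fourier_toHardy2, toeplitz_toHardy2, BddAnalytic.fourierCoeff_toHardy2,
      ← hu0]
    -- Since b(0) = 0, the coefficient of z in b u is the value at the origin of (b/z) u, which is
    -- multiplicative.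
    have := ((BddAnalytic.coe b).divide h0).fourierCoeff_mul_zero hu
    simp only [mul_assoc, fourierCoeff_divide, zero_add] at this
    exact this
  have h4 := norm_inner_toeplitz_sq_le hb g hu.toHardy2
  rw [h3] at h4
  have h5 := abs_le_of_sq_le_sq (h4.trans (mul_le_of_le_one_right (sq_nonneg _) h2)) (norm_nonneg _)
  rw [abs_of_nonneg (norm_nonneg _), norm_mul, Complex.norm_real, Real.norm_eq_abs, Real.abs_exp,
    Real.exp_neg, ← div_eq_mul_inv, div_le_iff₀ (Real.exp_pos _)] at h5
  have h6 : 0 < ‖g‖ := by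
    by_contra! h6
    have := norm_pos_iff.2 h1
    nlinarith [Real.exp_pos (∫ t, logReg (fun t => 1 - ‖(b : Lp ℂ ∞ arc) t‖ ^ 2) j t ∂arc)]
  rw [Real.log_le_iff_le_exp (div_pos (norm_pos_iff.2 h1) h6), div_le_iff₀' h6]
  exact h5

theorem exists_isPair {b : HInf} (hb : ‖b‖ ≤ 1) {C : ℝ}
    (hC : ∀ j, C ≤ ∫ t, logReg (fun t => 1 - ‖(b : Lp ℂ ∞ arc) t‖ ^ 2) j t ∂arc) :
    ∃ a : HInf, IsPair b a ∧ ∀ᵐ t ∂arc, (a : Lp ℂ ∞ arc) t ≠ 0 := by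
  have hw := isWeight_one_sub_norm_sq hb
  obtain ⟨v, hv⟩ := exists_isCompletion_logReg hw
  obtain ⟨hpos, hint, h, -, hh, -, hnorm, hext⟩ := exists_outer hw hv hC
  have he : ext (hh.toHInf : Lp ℂ ∞ arc) = ext h := ext_congr_ae hh.coeFn_toHInf
  refine ⟨hh.toHInf, ⟨⟨1, _, norm_one, hint, fun z hz => ?_⟩, ?_, ?_⟩, ?_⟩
  · rw [he, hext z hz, one_mul, herglotz]
  · rw [he, hext 0 (by simp), herglotz_zero, ← Complex.ofReal_exp]
    exact ⟨Real.exp_pos _, Complex.ofReal_im _⟩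
  · filter_upwards [hh.coeFn_toHInf, hnorm] with t ht1 ht2
    rw [ht1, ht2]
    ring
  · filter_upwards [hh.coeFn_toHInf, hnorm, hpos] with t ht1 ht2 ht3 h0
    rw [ht1] at h0
    rw [← ht2, h0] at ht3
    simp at ht3

theorem norm_le_of_ae_le {f : HInf} {C : ℝ} (hC : 0 ≤ C)
    (h : ∀ᵐ t ∂arc, ‖(f : Lp ℂ ∞ arc) t‖ ≤ C) : ‖f‖ ≤ C := by
  have := Lp.norm_le_of_ae_bound (f := (f : Lp ℂ ∞ arc)) hC h
  simpa using this

/-- The perturbation d = a²/2 works: |b| + |d| = |b| + (1 - |b|²)/2 ≤ 1 because (1 - |b|)² ≥ 0. So b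
is the midpoint of b + d and b - d in the ball, with d nonzero. -/
theorem nonExtreme_of_isPair {b a : HInf} (hb : ‖b‖ ≤ 1) (h : IsPair b a)
    (ha : ∀ᵐ t ∂arc, (a : Lp ℂ ∞ arc) t ≠ 0) : NonExtreme b := by
  refine ⟨by simpa using hb, fun hex => ?_⟩
  have haa := (BddAnalytic.coe a).mul (BddAnalytic.coe a)
  set d : HInf := (1 / 2 : ℂ) • haa.toHInf with hd
  have hdt : ∀ᵐ t ∂arc, (d : Lp ℂ ∞ arc) t =
      1 / 2 * ((a : Lp ℂ ∞ arc) t * (a : Lp ℂ ∞ arc) t) := by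
    filter_upwards [haa.coeFn_toHInf,
      Lp.coeFn_smul (1 / 2 : ℂ) (haa.toHInf : Lp ℂ ∞ arc)] with t ht1 ht2
    rw [hd, Submodule.coe_smul, ht2, Pi.smul_apply, ht1, smul_eq_mul]
  have hsum : ∀ᵐ t ∂arc, ‖(b : Lp ℂ ∞ arc) t‖ + ‖(d : Lp ℂ ∞ arc) t‖ ≤ 1 := by
    filter_upwards [hdt, h.2.2] with t ht1 ht2
    rw [ht1, norm_mul, norm_mul]
    norm_num
    nlinarith [sq_nonneg (1 - ‖(b : Lp ℂ ∞ arc) t‖)]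
  have hadd : b + d ∈ Metric.closedBall (0 : HInf) 1 := by
    rw [mem_closedBall_zero_iff]
    refine norm_le_of_ae_le zero_le_one ?_
    filter_upwards [Lp.coeFn_add (b : Lp ℂ ∞ arc) (d : Lp ℂ ∞ arc), hsum] with t ht1 ht2
    rw [Submodule.coe_add, ht1]
    exact (norm_add_le _ _).trans ht2
  have hsub : b - d ∈ Metric.closedBall (0 : HInf) 1 := by
    rw [mem_closedBall_zero_iff]
    refine norm_le_of_ae_le zero_le_one ?_
    filter_upwards [Lp.coeFn_sub (b : Lp ℂ ∞ arc) (d : Lp ℂ ∞ arc), hsum] with t ht1 ht2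
    rw [Submodule.coe_sub, ht1]
    exact (norm_sub_le _ _).trans ht2
  have hseg : b ∈ openSegment ℝ (b + d) (b - d) :=
    ⟨1 / 2, 1 / 2, by norm_num, by norm_num, by norm_num, by module⟩
  have hd0 : d = 0 := by simpa using ((mem_extremePoints.1 hex).2 _ hadd _ hsub hseg).1
  obtain ⟨t, ht1, ht2, ht3⟩ := (hdt.and (ha.and (Lp.coeFn_zero ℂ ∞ arc))).exists
  rw [hd0, Submodule.coe_zero, ht3] at ht1
  simp [ht2] at ht1

theorem isInner_id : IsInner fun z => z := by
  refine ⟨differentiableOn_id, fun z hz => by simpa using (Metric.mem_ball.1 hz).le,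
    ae_of_all _ fun t => ⟨pt t, norm_pt t, ?_⟩⟩
  have : Continuous fun r : ℝ => (r : ℂ) * pt t := by fun_prop
  simpa using (this.tendsto 1).mono_left nhdsWithin_le_nhds

end DBR

theorem theoremT (b : DBR.HInf) (hb : ‖b‖ ≤ 1) (ω : ℂ → ℝ)
    (hω : ∀ᵐ z ∂DBR.area, 0 ≤ ω z) (hint : MeasureTheory.Integrable ω DBR.area)
    (hpos : 0 < ∫ z, ‖ω z‖ ∂DBR.area) (heq : DBR.EqualWithNorms b ω) :
    DBR.NonExtreme b ∧
      DBR.IsInnerFactor (fun z => z) (DBR.ext (b : MeasureTheory.Lp ℂ ⊤ DBR.arc)) ∧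
      (∃ a : DBR.HInf, DBR.IsPair b a) ∧
      ∀ a : DBR.HInf, DBR.IsPair b a →
        DBR.IsInnerFactor (fun z => z)
          (fun z => DBR.ext (b : MeasureTheory.Lp ℂ ⊤ DBR.arc) z /
            DBR.ext (a : MeasureTheory.Lp ℂ ⊤ DBR.arc) z) := by
  obtain ⟨C, hC⟩ := DBR.le_integral_logReg_one_sub_norm_sq hb hω hint hpos heq
  obtain ⟨a, ha, ha0⟩ := DBR.exists_isPair hb hC
  obtain ⟨c, k, hc, hk, hbk⟩ := DBR.ext_eq_mul_outer hb hω hint hpos heq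
  refine ⟨DBR.nonExtreme_of_isPair hb ha ha0,
    ⟨DBR.isInner_id, _, ⟨c, k, hc, hk, fun z _ => rfl⟩, hbk⟩, ⟨a, ha⟩, fun a' ha' => ?_⟩
  obtain ⟨c', k', hc', hk', hak'⟩ := ha'.1
  -- Outer functions are closed under quotients: the unimodular constants divide and the exponents
  -- subtract. This needs only the outer representation of a', so it covers every pair.
  refine ⟨DBR.isInner_id, _, ⟨c / c', fun t => k t - k' t, by rw [norm_div, hc, hc', div_one],
    hk.sub hk', fun z _ => rfl⟩, fun z hz => ?_⟩
  have h := DBR.herglotz_sub hk hk' hz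
  simp only [hbk z hz, hak' z hz]
  rw [← DBR.herglotz, ← DBR.herglotz, h, Complex.exp_sub]
  ring
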